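/- Let $p$ be a prime, $q$ a power of $p$, $C$ a nonsingular projective (irreducible) curve over the finite field $\mathbb{F}_q$, $\infty$ a closed point of $C$, and $A$ the ring of functions on $C$ that are regular everywhere except possibly at $\infty$. Let $K$ be a finitely generated field of characteristic $p$ containing $\mathbb{F}_q$, let $K^{\mathrm{alg}}$ be an algebraic closure of $K$, and let $K^{\mathrm{per}}\subset K^{\mathrm{alg}}$ be the perfect closure of $K$. Let $K\{\tau\}$ be the ring of polynomials in the Frobenius $\tau\colon x\mapsto x^q$ with coefficients in $K$, with multiplication $\tau c=c^q\tau$. Fix a morphism of $\mathbb{F}_q$-algebras $i\colon A\to K$, and let $\phi\colon A\to K\{\tau\}$, $a\mapsto\phi_a$, be a Drinfeld module: a ring homomorphism such that the coefficient of $\tau^0$ in $\phi_a$ is $i(a)$ for every $a\in A$, and $\phi_a\neq i(a)\tau^0$ for some $a\in A$. For $\gamma\in K^{\mathrm{alg}}\setminus\{0\}$ let $\phi^{(\gamma)}$ be the conjugate Drinfeld module $a\mapsto\gamma^{-1}\phi_a\gamma$; its field of definition is the smallest subfield of $K^{\mathrm{alg}}$ containing the coefficients of all $\gamma^{-1}\phi_a\gamma$,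 $a\in A$. Assume that $\phi$ has positive modular transcendence degree, i.e. that the minimum over all $\gamma\in K^{\mathrm{alg}}\setminus\{0\}$ of the transcendence degree over $\mathbb{F}_p$ of the field of definition of $\phi^{(\gamma)}$ is positive. Let $\phi(K^{\mathrm{per}})$ be the additive group of $K^{\mathrm{per}}$ with the $A$-module structure in which $a\in A$ acts by $x\mapsto\phi_a(x)$, where $\big(\sum_n a_n\tau^n\big)(x)=\sum_n a_nx^{q^n}$. Then $\phi(K^{\mathrm{per}})$ is the direct sum of a finite torsion $A$-submodule and a free $A$-submodule of rank $\aleph_0$. -/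

import Mathlib

noncomputable section

/-! ### The ring `A` of functions on a curve that are regular away from one closed point

A nonsingular projective curve over a field `k` is given by its function field `F`: the closed
points of the curve are the places of `F / k`, the local ring at a point is the corresponding
valuation ring, and the functions regular on an open set are the intersection of the local rings
at its points. -/

/-- `F` is the function field of a curve over `k`: a finitely generated field extension of
transcendence degree one. -/
structure IsCurveFunctionField (k F : Type*) [Field k] [Field F] [Algebra k F] : Prop where
  fg : (⊤ : IntermediateField k F).FG
  trdeg_eq_one : Algebra.trdeg k F = 1

/-- The closed points of the nonsingular projective curve over `k` with function field `F`, each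
given by its local ring: the valuation rings of `F` containing `k`, other than `F` itself. -/
def CurvePoint (k F : Type*) [Field k] [Field F] [Algebra k F] : Type _ :=
  {O : ValuationSubring F // O ≠ ⊤ ∧ ∀ c : k, algebraMap k F c ∈ O}

/-- The ring of functions on the nonsingular projective curve over `k` with function field `F`
that are regular everywhere except possibly at the closed point `P`. -/
def regularAway {k F : Type*} [Field k] [Field F] [Algebra k F] (P : CurvePoint k F) :
    Subalgebra k F where
  carrier := {f | ∀ Q : CurvePoint k F, Q ≠ P → f ∈ Q.1}
  mul_mem' hf hg Q hQ := mul_mem (hf Q hQ) (hg Q hQ)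
  add_mem' hf hg Q hQ := add_mem (hf Q hQ) (hg Q hQ)
  algebraMap_mem' c Q _ := Q.2.2 c

/-! ### Finitely generated fields -/

/-- A field is finitely generated (over its prime field). -/
def IsFinitelyGeneratedField (K : Type*) [Field K] : Prop :=
  ∃ s : Finset K, Subfield.closure (s : Set K) = ⊤

/-! ### The ring `K{τ}` -/

section Twisted

variable (Fq : Type*) [Field Fq] [Fintype Fq]

/-- The action of the monoid `{1, τ, τ², …}` on an `𝔽_q`-algebra, `τ` acting by `x ↦ x ^ q`. -/
@[reducible] def frobeniusAction (K : Type*) [Field K] [Algebra Fq K] :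
    MulSemiringAction (Multiplicative ℕ) K :=
  MulSemiringAction.compHom K
    (powersHom (K →+* K) (FiniteField.frobeniusAlgHom Fq K : K →+* K))

theorem frobeniusAction_smul (K : Type*) [Field K] [Algebra Fq K] (n : ℕ) (x : K) :
    (frobeniusAction Fq K).smul (Multiplicative.ofAdd n) x = x ^ Fintype.card Fq ^ n := by
  change ((FiniteField.frobeniusAlgHom Fq K : K →+* K) ^ n) x = _
  induction n generalizing x with
  | zero => simp
  | succ n ih =>
    rw [pow_succ, RingHom.mul_def, RingHom.comp_apply, ih, pow_succ', pow_mul]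
    rfl

/-- The ring `K{τ}` of polynomials in `τ` with coefficients in `K`, where `τ` is the `q`-power
Frobenius, so that `τ c = c ^ q τ`. -/
def TwistedPoly (K : Type*) [Field K] [Algebra Fq K] : Type _ := SkewPolynomial K

namespace TwistedPoly

variable {Fq} {K : Type*} [Field K] [Algebra Fq K]

instance : Ring (TwistedPoly Fq K) :=
  letI := frobeniusAction Fq K
  inferInstanceAs (Ring (SkewPolynomial K))

/-- The coefficient of `τ ^ n`. -/
def coeff (f : TwistedPoly Fq K) (n : ℕ) : K := SkewPolynomial.coeff f n

/-- The set of `n` for which the coefficient of `τ ^ n` is not zero. -/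
def support (f : TwistedPoly Fq K) : Finset ℕ := SkewPolynomial.support f

/-- The monomial `a τ ^ n`. -/
def monomial (n : ℕ) (a : K) : TwistedPoly Fq K := SkewPolynomial.monomial n a

/-- The embedding of `K` in `K{τ}` as the constants `a τ⁰`. -/
def C : K →+* TwistedPoly Fq K :=
  letI := frobeniusAction Fq K
  (SkewPolynomial.CRingHom : K →+* SkewPolynomial K)

theorem ext_coeff {f g : TwistedPoly Fq K} (h : ∀ n, f.coeff n = g.coeff n) : f = g :=
  SkewMonoidAlgebra.ext fun n => h n.toAdd

theorem coeff_add (f g : TwistedPoly Fq K) (n : ℕ) :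
    (f + g).coeff n = f.coeff n + g.coeff n :=
  congrArg (fun h => h (Multiplicative.ofAdd n)) (SkewMonoidAlgebra.coeff_add (k := K)
    (G := Multiplicative ℕ) f g)

theorem C_apply (a : K) : C a = (monomial 0 a : TwistedPoly Fq K) := rfl

theorem coeff_C (a : K) (n : ℕ) : (C a : TwistedPoly Fq K).coeff n = if n = 0 then a else 0 :=
  SkewPolynomial.coeff_C

theorem monomial_mul_monomial (m n : ℕ) (a b : K) :
    (monomial m a * monomial n b : TwistedPoly Fq K) =
      monomial (m + n) (a * b ^ Fintype.card Fq ^ m) := by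
  let _ := frobeniusAction Fq K
  have h := SkewPolynomial.monomial_mul_monomial (R := K) m n a b
  rw [SkewPolynomial.φ_iterate_apply] at h
  rw [← frobeniusAction_smul Fq K m b]
  exact h

theorem coeff_C_mul (a : K) (f : TwistedPoly Fq K) (n : ℕ) :
    (C a * f).coeff n = a * f.coeff n := by
  let _ := frobeniusAction Fq K
  have h := SkewMonoidAlgebra.coeff_single_one_mul (k := K) (G := Multiplicative ℕ) f a
    (Multiplicative.ofAdd n)
  exact h

theorem coeff_mul_C (a : K) (f : TwistedPoly Fq K) (n : ℕ) :
    (f * C a).coeff n = f.coeff n * a ^ Fintype.card Fq ^ n := by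
  let _ := frobeniusAction Fq K
  have h := SkewMonoidAlgebra.coeff_mul_single_one (k := K) (G := Multiplicative ℕ) f a
    (Multiplicative.ofAdd n)
  rw [← frobeniusAction_smul Fq K n a]
  exact h

/-- The ring homomorphism `K{τ} → R` given by a ring homomorphism `f : K → R` and an element `t`
of `R` with `t f(c) = f(c ^ q) t` for all `c`. -/
def lift {R : Type*} [Ring R] (f : K →+* R) (t : R)
    (h : ∀ c, t * f c = f (c ^ Fintype.card Fq) * t) : TwistedPoly Fq K →+* R :=
  letI := frobeniusAction Fq K
  (SkewMonoidAlgebra.liftNCRingHom f (powersHom R t) (by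
    intro c y
    have key : ∀ (n : ℕ) (c : K), f (c ^ Fintype.card Fq ^ n) * t ^ n = t ^ n * f c := by
      intro n
      induction n with
      | zero => simp
      | succ n ih =>
        intro c
        rw [pow_succ' (Fintype.card Fq), pow_mul, pow_succ, ← mul_assoc, ih, mul_assoc, ← h,
          mul_assoc]
    have hs : y • c = c ^ Fintype.card Fq ^ y.toAdd := frobeniusAction_smul Fq K y.toAdd c
    rw [hs]
    exact key y.toAdd c) : SkewMonoidAlgebra K (Multiplicative ℕ) →+* R)

theorem lift_apply {R : Type*} [Ring R] (f : K →+* R) (t : R)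
    (h : ∀ c, t * f c = f (c ^ Fintype.card Fq) * t) (g : TwistedPoly Fq K) :
    lift f t h g = ∑ n ∈ g.support, f (g.coeff n) * t ^ n := by
  exact SkewPolynomial.sum_def (R := K) (p := g) fun n c => f c * t ^ n

theorem monomial_one_one_pow (n : ℕ) :
    (monomial 1 1 : TwistedPoly Fq K) ^ n = monomial n 1 := by
  induction n with
  | zero => rfl
  | succ n ih => rw [pow_succ, ih, monomial_mul_monomial, one_pow, one_mul]

theorem coeff_monomial (m n : ℕ) (a : K) :
    (monomial m a : TwistedPoly Fq K).coeff n = if m = n then a else 0 :=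
  SkewPolynomial.coeff_monomial

theorem coeff_sum {ι : Type*} (s : Finset ι) (f : ι → TwistedPoly Fq K) (n : ℕ) :
    (∑ j ∈ s, f j).coeff n = ∑ j ∈ s, (f j).coeff n :=
  map_sum (AddMonoidHom.mk' (fun g : TwistedPoly Fq K => g.coeff n)
    fun g h => coeff_add g h n) f s

/-- The change of coefficients `K{τ} → E{τ}`. -/
def map {E : Type*} [Field E] [Algebra Fq E] (σ : K →ₐ[Fq] E) :
    TwistedPoly Fq K →+* TwistedPoly Fq E :=
  lift (C.comp (σ : K →+* E)) (monomial 1 1) (by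
    intro c
    simp [C_apply, monomial_mul_monomial])

theorem coeff_map {E : Type*} [Field E] [Algebra Fq E] (σ : K →ₐ[Fq] E)
    (f : TwistedPoly Fq K) (n : ℕ) : (map σ f).coeff n = σ (f.coeff n) := by
  have h1 : ∀ m ∈ f.support, ((C.comp (σ : K →+* E)) (f.coeff m) * (monomial 1 1) ^ m :
      TwistedPoly Fq E).coeff n = if m = n then σ (f.coeff n) else 0 := by
    intro m _
    rw [monomial_one_one_pow, RingHom.comp_apply, coeff_C_mul, coeff_monomial]
    split_ifs with h
    · subst h; simp
    · simp
  rw [map, lift_apply, coeff_sum, Finset.sum_congr rfl h1, Finset.sum_ite_eq']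
  split_ifs with h
  · rfl
  · have h0 : f.coeff n = 0 := SkewPolynomial.notMem_support_iff.mp h
    rw [h0, map_zero]

/-- The additive map `x ↦ x ^ q` on a field `L` containing `K`. -/
def frobeniusEnd (Fq : Type*) [Field Fq] [Fintype Fq] (K : Type*) [Field K] [Algebra Fq K]
    (L : Type*) [Field L] [Algebra K L] : AddMonoid.End L :=
  letI : Algebra Fq L := ((algebraMap K L).comp (algebraMap Fq K)).toAlgebra
  ((FiniteField.frobeniusAlgHom Fq L : L →+* L) : L →+ L)

theorem frobeniusEnd_pow_apply (L : Type*) [Field L] [Algebra K L] (n : ℕ) (x : L) :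
    (frobeniusEnd Fq K L ^ n) x = x ^ Fintype.card Fq ^ n := by
  induction n generalizing x with
  | zero => simp
  | succ n ih =>
    rw [pow_succ, AddMonoid.End.coe_mul, Function.comp_apply, ih, pow_succ', pow_mul]
    rfl

/-- The action of `K{τ}` on a field `L` containing `K`: the polynomial `∑ aₙ τ ^ n` acts as
`x ↦ ∑ aₙ x ^ (q ^ n)`. -/
def toEnd (L : Type*) [Field L] [Algebra K L] : TwistedPoly Fq K →+* AddMonoid.End L :=
  lift (Module.toAddMonoidEnd K L) (frobeniusEnd Fq K L) (by
    intro c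
    ext x
    change (c • x) ^ Fintype.card Fq = c ^ Fintype.card Fq • x ^ Fintype.card Fq
    exact smul_pow _ _ _)

theorem toEnd_apply (L : Type*) [Field L] [Algebra K L] (f : TwistedPoly Fq K) (x : L) :
    toEnd L f x = ∑ n ∈ f.support, algebraMap K L (f.coeff n) * x ^ Fintype.card Fq ^ n := by
  rw [toEnd, lift_apply]
  refine (AddMonoidHom.finsetSum_apply _ _ _).trans (Finset.sum_congr rfl fun n _ => ?_)
  have h := frobeniusEnd_pow_apply (Fq := Fq) (K := K) L n x
  rw [← Algebra.smul_def, ← h]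
  rfl

end TwistedPoly

/-! ### Drinfeld modules -/

variable {Fq} {A K : Type*} [CommRing A] [Algebra Fq A] [Field K] [Algebra Fq K]

/-- A Drinfeld module `φ : A → K{τ}`, relative to a morphism `i : A → K`. -/
structure DrinfeldModule (i : A →ₐ[Fq] K) where
  toRingHom : A →+* TwistedPoly Fq K
  coeff_zero : ∀ a, (toRingHom a).coeff 0 = i a
  exists_ne : ∃ a, toRingHom a ≠ TwistedPoly.C (i a)

namespace DrinfeldModule

variable {i : A →ₐ[Fq] K}

/-- The Drinfeld module over `E` with the same coefficients as `φ`, for a field extension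
`E` of `K`. -/
def baseChange (φ : DrinfeldModule i) {E : Type*} [Field E] [Algebra Fq E] (σ : K →ₐ[Fq] E) :
    DrinfeldModule (σ.comp i) where
  toRingHom := (TwistedPoly.map σ).comp φ.toRingHom
  coeff_zero a := by simp [TwistedPoly.coeff_map, φ.coeff_zero]
  exists_ne := by
    obtain ⟨a, ha⟩ := φ.exists_ne
    refine ⟨a, fun h => ha (TwistedPoly.ext_coeff fun n => σ.toRingHom.injective ?_)⟩
    have h2 := congrArg (fun f => f.coeff n) h
    simp only [RingHom.comp_apply, TwistedPoly.coeff_map, TwistedPoly.coeff_C] at h2 ⊢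
    refine h2.trans ?_
    split_ifs <;> simp

/-- The conjugate Drinfeld module `φ^(γ)`, given by `a ↦ γ⁻¹ φ_a γ`. -/
def conj (φ : DrinfeldModule i) (γ : Kˣ) : DrinfeldModule i where
  toRingHom :=
    { toFun := fun a => TwistedPoly.C (γ : K)⁻¹ * φ.toRingHom a * TwistedPoly.C (γ : K)
      map_zero' := by simp
      map_one' := by rw [map_one, mul_one, ← map_mul, inv_mul_cancel₀ γ.ne_zero, map_one]
      map_add' := fun a b => by rw [map_add, mul_add, add_mul]
      map_mul' := fun a b => by
        have h : (TwistedPoly.C (γ : K) * TwistedPoly.C (γ : K)⁻¹ : TwistedPoly Fq K) = 1 := by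
          rw [← map_mul, mul_inv_cancel₀ γ.ne_zero, map_one]
        rw [map_mul]
        simp only [mul_assoc]
        rw [← mul_assoc (TwistedPoly.C (γ : K)) (TwistedPoly.C (γ : K)⁻¹), h, one_mul] }
  coeff_zero a := by
    change (TwistedPoly.C (γ : K)⁻¹ * φ.toRingHom a * TwistedPoly.C (γ : K)).coeff 0 = i a
    rw [TwistedPoly.coeff_mul_C, TwistedPoly.coeff_C_mul, φ.coeff_zero]
    rw [pow_zero, pow_one, mul_right_comm, inv_mul_cancel₀ γ.ne_zero, one_mul]
  exists_ne := by
    obtain ⟨a, ha⟩ := φ.exists_ne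
    refine ⟨a, fun h => ha (TwistedPoly.ext_coeff fun n => ?_)⟩
    have h2 := congrArg (fun f => f.coeff n) h
    change (TwistedPoly.C (γ : K)⁻¹ * φ.toRingHom a * TwistedPoly.C (γ : K)).coeff n = _ at h2
    rw [TwistedPoly.coeff_mul_C, TwistedPoly.coeff_C_mul] at h2
    by_cases hn : n = 0
    · subst hn
      rw [φ.coeff_zero, TwistedPoly.coeff_C, if_pos rfl]
    · simpa [TwistedPoly.coeff_C, hn] using h2

theorem coeff_conj (φ : DrinfeldModule i) (γ : Kˣ) (a : A) (n : ℕ) :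
    ((φ.conj γ).toRingHom a).coeff n =
      (φ.toRingHom a).coeff n * (γ : K) ^ (Fintype.card Fq ^ n - 1) := by
  change (TwistedPoly.C (γ : K)⁻¹ * φ.toRingHom a * TwistedPoly.C (γ : K)).coeff n = _
  have hq : Fintype.card Fq ^ n ≠ 0 := pow_ne_zero _ Fintype.card_ne_zero
  rw [TwistedPoly.coeff_mul_C, TwistedPoly.coeff_C_mul, mul_right_comm, mul_comm,
    ← mul_pow_sub_one hq (γ : K), inv_mul_cancel_left₀ γ.ne_zero]

/-- The field of definition of `φ`: the smallest subfield of `K` containing all the coefficients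
of `φ_a` for all `a` in `A`. -/
def fieldOfDefinition (φ : DrinfeldModule i) : Subfield K :=
  Subfield.closure {c | ∃ (a : A) (n : ℕ), c = (φ.toRingHom a).coeff n}

/-- The modular transcendence degree of `φ`, computed in an algebraic closure `Ω` of `K`: the
minimum over all nonzero `γ` in `Ω` of the transcendence degree of the field of definition of
`φ^(γ)` over the prime field `𝔽_p`. The infimum is attained, as cardinals are well ordered. -/
def modularTrdeg (φ : DrinfeldModule i) (Ω : Type*) [Field Ω] [Algebra Fq Ω] [Algebra K Ω]
    [IsScalarTower Fq K Ω] : Cardinal :=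
  ⨅ γ : Ωˣ,
    let E := ((φ.baseChange (IsScalarTower.toAlgHom Fq K Ω)).conj γ).fieldOfDefinition
    Algebra.trdeg (⊥ : Subfield E) E

/-- The `A`-module `φ(L)`, for a field `L` containing `K`: the additive group of `L`, on which
`a` in `A` acts as `φ_a`. -/
def Points (_φ : DrinfeldModule i) (L : Type*) [Field L] [Algebra K L] : Type _ := L

instance (φ : DrinfeldModule i) (L : Type*) [Field L] [Algebra K L] :
    AddCommGroup (φ.Points L) :=
  inferInstanceAs (AddCommGroup L)

instance (φ : DrinfeldModule i) (L : Type*) [Field L] [Algebra K L] :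
    Module A (φ.Points L) where
  smul a x := TwistedPoly.toEnd L (φ.toRingHom a) x
  one_smul x := by
    change TwistedPoly.toEnd L (φ.toRingHom 1) x = x
    rw [map_one, map_one]; rfl
  mul_smul a b x := by
    change TwistedPoly.toEnd L (φ.toRingHom (a * b)) x = _
    rw [map_mul, map_mul]; rfl
  smul_zero a := map_zero (TwistedPoly.toEnd L (φ.toRingHom a))
  smul_add a x y := map_add (TwistedPoly.toEnd L (φ.toRingHom a)) x y
  add_smul a b x := by
    change TwistedPoly.toEnd L (φ.toRingHom (a + b)) x = _
    rw [map_add, map_add]; rfl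
  zero_smul x := by
    change TwistedPoly.toEnd L (φ.toRingHom 0) x = _
    rw [map_zero, map_zero]; rfl

theorem smul_points_def (φ : DrinfeldModule i) (L : Type*) [Field L] [Algebra K L] (a : A)
    (x : φ.Points L) :
    a • x = TwistedPoly.toEnd L (φ.toRingHom a) x := rfl

end DrinfeldModule
end Twisted

end

/-! Choose `t` in the coordinate ring `A` with `φ_t` of degree `r ≥ 2` in `τ`, and `γ` making `ψ_t =
γ⁻¹ φ_t γ` a monic additive polynomial `f`. If all coefficients of `f` were algebraic over `𝔽_p`, so
would be those of every `ψ_a`, since `ψ_a` commutes with `f` (`coeff_mem_of_commute`). Positive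
modular transcendence degree therefore makes some coefficient of `f` transcendental. Places are
taken on the perfect closure `κ` of `K(γ)`, over a subfield `E` such that `κ` has transcendence
degree at most one over `E` and this coefficient is still transcendental.

Let `X` act on the points as `φ_t`. The core is that, over `𝔽_q[X]`, saturations of finitely
generated submodules are finitely generated and the torsion is finite. This rests on a finite set of
points of small height (`finite_smallPoints`): at the finitely many places where `f` is not
integral, a small point is near a root of `f`. Two distinct small points near the same roots would
give, after clearing denominators, a nonzero element integral over `E` that lies in the maximal
ideal of some place, which is impossible. A point `z` with `G z = ∑ εᵢ xᵢ` and each `deg εᵢ` well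
below `deg G` is small (`exists_forall_mem_smallPoints`): at large values `f` raises the absolute
value exactly to the power `q ^ r`, and in a perfect field a denominator may be replaced by a root
of it. A pigeonhole on Euclidean quotients then yields finitely many generators of a saturation
(`fg_saturation_of_finite`).

The ring `A` is the integral closure of `𝔽_q[t]`. It embeds in the module as the orbit of a
nontorsion point, hence is finite over `𝔽_q[t]` and Dedekind, and finiteness of saturations passes
to `A`. A countable torsion-free `A`-module with this finiteness that is not finitely generated is a
direct sum of nonzero finitely generated projectives. Consecutive pairs of these map onto `A`, so
the module has a free summand of countable rank, and Eilenberg's swindle makes it free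
(`nonempty_equiv_finsupp_nat`). Applied modulo torsion, this splits the torsion off.

Finally, the points are not finitely generated: otherwise `K^per` would lie in some `K^(1/p^N)`, so
`K` would be perfect, and a finitely generated perfect field is algebraic over `𝔽_p`. -/

/-! ### Additive polynomials and valuations -/

section AdditivePolynomial

variable (Fq : Type*) [Field Fq] [Fintype Fq] {κ : Type*} [Field κ] [Algebra Fq κ]

/-- The `𝔽_q`-linear map `x ↦ ∑ aᵢ x ^ (q ^ i)`, the sum being over `i ≤ r`. -/
noncomputable def additivePoly (r : ℕ) (a : ℕ → κ) : Module.End Fq κ :=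
  ∑ i ∈ Finset.range (r + 1),
    LinearMap.mulLeft Fq (a i) ∘ₗ (FiniteField.frobeniusAlgHom Fq κ ^ i).toLinearMap

theorem frobeniusAlgHom_pow_apply (i : ℕ) (x : κ) :
    (FiniteField.frobeniusAlgHom Fq κ ^ i) x = x ^ Fintype.card Fq ^ i := by
  induction i generalizing x with
  | zero => simp
  | succ n ih => rw [pow_succ, AlgHom.mul_apply, ih, pow_succ', pow_mul]; rfl

theorem additivePoly_apply (r : ℕ) (a : ℕ → κ) (x : κ) :
    additivePoly Fq r a x = ∑ i ∈ Finset.range (r + 1), a i * x ^ Fintype.card Fq ^ i := by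
  rw [additivePoly, LinearMap.sum_apply]
  refine Finset.sum_congr rfl fun i _ => ?_
  rw [LinearMap.comp_apply, LinearMap.mulLeft_apply, AlgHom.toLinearMap_apply,
    frobeniusAlgHom_pow_apply]

variable {Fq} {Γ : Type*} [LinearOrderedCommGroupWithZero Γ] (v : Valuation κ Γ)

/-- Nonzero constants are roots of unity, and an ordered group has no torsion. -/
theorem Valuation.map_finite_const {c : Fq} (hc : c ≠ 0) : v (algebraMap Fq κ c) = 1 := by
  have h : v (algebraMap Fq κ c) ^ (Fintype.card Fq - 1) = 1 := by
    rw [← map_pow, ← map_pow, FiniteField.pow_card_sub_one_eq_one c hc, map_one, map_one]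
  exact (pow_eq_one_iff_of_nonneg zero_le (by have := Fintype.one_lt_card (α := Fq); omega)).1 h

theorem Valuation.map_finite_const_smul_le (c : Fq) (x : κ) : v (c • x) ≤ v x := by
  rw [Algebra.smul_def, map_mul]
  rcases eq_or_ne c 0 with rfl | hc
  · simp
  · rw [Valuation.map_finite_const v hc, one_mul]

variable {r : ℕ} {a : ℕ → κ}

/-- A coefficient below the top costs one extra factor `C`, absorbed by `1 + q ^ i ≤ q ^ r`;
monicity spares the top term this factor. -/
theorem valuation_additivePoly_le (ha : a r = 1) {C : Γ} (h1 : 1 ≤ C)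
    (hC : ∀ i ≤ r, v (a i) ≤ C) {x : κ} (hx : v x ≤ C) :
    v (additivePoly Fq r a x) ≤ C ^ Fintype.card Fq ^ r := by
  rw [additivePoly_apply]
  refine v.map_sum_le fun i hi => ?_
  have hi' : i ≤ r := Nat.lt_succ_iff.1 (Finset.mem_range.1 hi)
  have hq : 2 ≤ Fintype.card Fq := Fintype.one_lt_card
  rw [map_mul, map_pow]
  rcases hi'.eq_or_lt with rfl | hlt
  · rw [ha, map_one, one_mul]; gcongr
  · calc v (a i) * v x ^ Fintype.card Fq ^ i ≤ C * C ^ Fintype.card Fq ^ i := by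
          gcongr; exact hC i hi'
      _ = C ^ (1 + Fintype.card Fq ^ i) := by rw [pow_add, pow_one]
      _ ≤ C ^ Fintype.card Fq ^ r := by
          refine pow_le_pow_right₀ h1 ?_
          have h2 : Fintype.card Fq ^ (i + 1) ≤ Fintype.card Fq ^ r :=
            Nat.pow_le_pow_right (by omega) hlt
          have h3 : 1 ≤ Fintype.card Fq ^ i := Nat.one_le_pow _ _ (by omega)
          rw [pow_succ] at h2
          nlinarith

theorem valuation_additivePoly_pow_le (ha : a r = 1) {C : Γ} (h1 : 1 ≤ C)
    (hC : ∀ i ≤ r, v (a i) ≤ C) {x : κ} (hx : v x ≤ C) (n : ℕ) :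
    v ((additivePoly Fq r a ^ n) x) ≤ C ^ Fintype.card Fq ^ (r * n) := by
  induction n with
  | zero => simpa using hx
  | succ n ih =>
    have hq : 0 < Fintype.card Fq := Fintype.card_pos
    have h := valuation_additivePoly_le (Fq := Fq) v ha (C := C ^ Fintype.card Fq ^ (r * n))
      (one_le_pow₀ h1) (fun i hi => (hC i hi).trans
        (le_self_pow₀ h1 (pow_pos hq _).ne')) ih
    rw [pow_succ', Module.End.mul_apply, mul_add, mul_one, pow_add, pow_mul]
    exact h

theorem valuation_aeval_additivePoly_le (ha : a r = 1) {C : Γ} (h1 : 1 ≤ C)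
    (hC : ∀ i ≤ r, v (a i) ≤ C) {x : κ} (hx : v x ≤ C) (G : Polynomial Fq) :
    v (Polynomial.aeval (additivePoly Fq r a) G x) ≤
      C ^ Fintype.card Fq ^ (r * G.natDegree) := by
  have hq : 0 < Fintype.card Fq := Fintype.card_pos
  rw [Polynomial.aeval_eq_sum_range, LinearMap.sum_apply]
  refine v.map_sum_le fun i hi => ?_
  rw [LinearMap.smul_apply]
  refine (Valuation.map_finite_const_smul_le v _ _).trans
    ((valuation_additivePoly_pow_le v ha h1 hC hx i).trans (pow_le_pow_right₀ h1 ?_))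
  have : i ≤ G.natDegree := Nat.lt_succ_iff.1 (Finset.mem_range.1 hi)
  exact Nat.pow_le_pow_right hq (by gcongr)

/-- The top term dominates because `2 + q ^ i ≤ q ^ r` for `i < r`, which needs `r ≥ 2`.
Coefficients are allowed up to the square of the size of the point because smallness of points is
later measured by `v (f z) ^ 2`. -/
theorem valuation_additivePoly_eq (hr : 2 ≤ r) (ha : a r = 1) {y : κ} (hy : 1 < v y)
    (hay : ∀ i < r, v (a i) < v y ^ 2) :
    v (additivePoly Fq r a y) = v y ^ Fintype.card Fq ^ r := by
  have hq : 2 ≤ Fintype.card Fq := Fintype.one_lt_card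
  have hlt : v (∑ i ∈ Finset.range r, a i * y ^ Fintype.card Fq ^ i) <
      v (y ^ Fintype.card Fq ^ r) := by
    refine v.map_sum_lt (by simpa using (zero_lt_one.trans hy).ne') fun i hi => ?_
    have hi' := Finset.mem_range.1 hi
    have hpos : (0 : Γ) < v y := zero_lt_one.trans hy
    rw [map_mul, map_pow, map_pow]
    calc v (a i) * v y ^ Fintype.card Fq ^ i < v y ^ 2 * v y ^ Fintype.card Fq ^ i := by
          exact mul_lt_mul_of_pos_right (hay i hi') (pow_pos hpos _)
      _ = v y ^ (2 + Fintype.card Fq ^ i) := by rw [pow_add]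
      _ ≤ v y ^ Fintype.card Fq ^ r := by
          refine pow_le_pow_right₀ hy.le ?_
          have h1 : Fintype.card Fq ^ (r - 1 + 1) = Fintype.card Fq ^ r := by
            congr 1; omega
          have h2 : Fintype.card Fq ^ i ≤ Fintype.card Fq ^ (r - 1) :=
            Nat.pow_le_pow_right (by omega) (by omega)
          have h3 : Fintype.card Fq ^ 1 ≤ Fintype.card Fq ^ (r - 1) :=
            Nat.pow_le_pow_right (by omega) (by omega)
          rw [pow_succ] at h1
          nlinarith
  rw [additivePoly_apply, Finset.sum_range_succ, ha, one_mul, v.map_add_eq_of_lt_right hlt,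
    map_pow]

theorem valuation_additivePoly_pow_eq (hr : 2 ≤ r) (ha : a r = 1) {y : κ} (hy : 1 < v y)
    (hay : ∀ i < r, v (a i) < v y ^ 2) (n : ℕ) :
    v ((additivePoly Fq r a ^ n) y) = v y ^ Fintype.card Fq ^ (r * n) := by
  have hq : 0 < Fintype.card Fq := Fintype.card_pos
  induction n with
  | zero => simp
  | succ n ih =>
    have hle : v y ≤ v ((additivePoly Fq r a ^ n) y) := by
      rw [ih]; exact le_self_pow₀ hy.le (pow_pos hq _).ne'
    rw [pow_succ', Module.End.mul_apply, valuation_additivePoly_eq v hr ha (hy.trans_le hle)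
      (fun i hi => (hay i hi).trans_le (by gcongr)), ih, mul_add, mul_one, pow_add, ← pow_mul]

/-- The iterates of `y` have strictly increasing values, so nothing can cancel the leading one. -/
theorem valuation_aeval_additivePoly_eq (hr : 2 ≤ r) (ha : a r = 1) {y : κ} (hy : 1 < v y)
    (hay : ∀ i < r, v (a i) < v y ^ 2) {G : Polynomial Fq} (hG : G ≠ 0) :
    v (Polynomial.aeval (additivePoly Fq r a) G y) =
      v y ^ Fintype.card Fq ^ (r * G.natDegree) := by
  have hq : 2 ≤ Fintype.card Fq := Fintype.one_lt_card
  have hpos : (0 : Γ) < v y := zero_lt_one.trans hy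
  have htop : v (G.leadingCoeff • (additivePoly Fq r a ^ G.natDegree) y) =
      v y ^ Fintype.card Fq ^ (r * G.natDegree) := by
    rw [Algebra.smul_def, map_mul, Valuation.map_finite_const v
      (Polynomial.leadingCoeff_ne_zero.2 hG), one_mul, valuation_additivePoly_pow_eq v hr ha hy hay]
  rw [Polynomial.aeval_eq_sum_range, LinearMap.sum_apply, Finset.sum_range_succ,
    LinearMap.smul_apply]
  rw [Polynomial.coeff_natDegree, v.map_add_eq_of_lt_right, htop]
  rw [htop]
  refine v.map_sum_lt (pow_pos hpos _).ne' fun i hi => ?_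
  rw [LinearMap.smul_apply]
  refine (Valuation.map_finite_const_smul_le v _ _).trans_lt ?_
  rw [valuation_additivePoly_pow_eq v hr ha hy hay]
  refine pow_lt_pow_right₀ hy (Nat.pow_lt_pow_right (by omega) ?_)
  exact Nat.mul_lt_mul_of_pos_left (Finset.mem_range.1 hi) (by omega)

end AdditivePolynomial

/-! ### Points with small image are near a root -/

section NearRoot

open Polynomial

/-- Both coefficients of a factor `z X - ρ` are bounded by `v (z - ρ)`: the first by hypothesis, the
second by the ultrametric inequality. Applied to `P(z X)`, this compares each term of `P` at `z`
with `P(z)`. -/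
theorem valuation_coeff_multiset_prod_le {K Γ : Type*} [Field K]
    [LinearOrderedCommGroupWithZero Γ] (v : Valuation K Γ) {z : K} {s : Multiset K}
    (hs : ∀ ρ ∈ s, v z ≤ v (z - ρ)) (n : ℕ) :
    v ((s.map fun ρ => C z * X - C ρ).prod.coeff n) ≤ (s.map fun ρ => v (z - ρ)).prod := by
  induction s using Multiset.induction_on generalizing n with
  | empty =>
    simp only [Multiset.map_zero, Multiset.prod_zero, coeff_one]
    split_ifs <;> simp
  | cons ρ s ih =>
    have hz : v z ≤ v (z - ρ) := hs ρ (Multiset.mem_cons_self _ _)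
    have hρ : v ρ ≤ v (z - ρ) := by
      have : v ρ = v (z - (z - ρ)) := by rw [sub_sub_cancel]
      rw [this]
      exact (v.map_sub _ _).trans (max_le hz le_rfl)
    have ih' := ih fun ρ' h => hs ρ' (Multiset.mem_cons_of_mem h)
    rw [Multiset.map_cons, Multiset.prod_cons, Multiset.map_cons, Multiset.prod_cons, sub_mul,
      mul_assoc, coeff_sub, coeff_C_mul, coeff_C_mul]
    refine (v.map_sub _ _).trans (max_le ?_ ?_)
    · rw [map_mul]
      refine mul_le_mul' hz ?_
      cases n with
      | zero => simp
      | succ n => rw [coeff_X_mul]; exact ih' n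
    · rw [map_mul]; exact mul_le_mul' hρ (ih' n)

/-- A valuation ring of `L` dominating `O` does it: if `x` is outside `O`, then `x⁻¹` is a nonunit
of `O`, and a local homomorphism cannot make it a unit. -/
theorem ValuationSubring.exists_comap_eq {K L : Type*} [Field K] [Field L] (f : K →+* L)
    (O : ValuationSubring K) : ∃ O' : ValuationSubring L, O'.comap f = O := by
  obtain ⟨B, h, hloc⟩ := IsLocalRing.exists_factor_valuationRing (f.comp O.subtype)
  refine ⟨B, le_antisymm (fun x hx => ?_) fun x hx => h ⟨x, hx⟩⟩
  by_contra hxO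
  have hx0 : x ≠ 0 := by rintro rfl; exact hxO O.zero_mem
  have hinv : x⁻¹ ∈ O := (O.mem_or_inv_mem x).resolve_left hxO
  have hu : IsUnit ((f.comp O.subtype).codRestrict B.toSubring h ⟨x⁻¹, hinv⟩) := by
    refine IsUnit.of_mul_eq_one ⟨f x, hx⟩ (Subtype.ext ?_)
    change f x⁻¹ * f x = 1
    rw [← map_mul, inv_mul_cancel₀ hx0, map_one]
  obtain ⟨u, hu'⟩ := isUnit_of_map_unit _ _ hu
  have h1 : ((u * u⁻¹ : Oˣ) : O).1 = 1 := by simp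
  have h2 : x⁻¹ * ((u⁻¹ : Oˣ) : O).1 = 1 := by
    rw [← h1]; change _ = (u : O).1 * _; rw [hu']
  have h3 : ((u⁻¹ : Oˣ) : O).1 = x := by
    field_simp at h2; exact h2
  exact hxO (h3 ▸ ((u⁻¹ : Oˣ) : O).2)

theorem ValuationSubring.valuation_le_iff_div_mem {K : Type*} [Field K]
    (O : ValuationSubring K) (x : K) {y : K} (hy : y ≠ 0) :
    O.valuation x ≤ O.valuation y ↔ x / y ∈ O := by
  rw [← ValuationSubring.valuation_le_one_iff, map_div₀,
    div_le_one₀ (zero_lt_iff.2 ((Valuation.ne_zero_iff _).2 hy))]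

theorem ValuationSubring.valuation_le_iff_of_comap_eq {K L : Type*} [Field K] [Field L]
    {f : K →+* L} {O : ValuationSubring K} {O' : ValuationSubring L} (h : O'.comap f = O)
    (x y : K) : O.valuation x ≤ O.valuation y ↔ O'.valuation (f x) ≤ O'.valuation (f y) := by
  rcases eq_or_ne y 0 with rfl | hy
  · simp
  · rw [O.valuation_le_iff_div_mem _ hy, O'.valuation_le_iff_div_mem _ ((map_ne_zero f).2 hy),
      ← map_div₀, ← h, ValuationSubring.mem_comap]

variable {Fq : Type*} [Field Fq] [Fintype Fq] {κ : Type*} [Field κ] [Algebra Fq κ]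

/-- The polynomial `∑ aᵢ X ^ (q ^ i)`. -/
noncomputable def additivePolynomial (q r : ℕ) (a : ℕ → κ) : κ[X] :=
  ∑ i ∈ Finset.range (r + 1), C (a i) * X ^ q ^ i

theorem eval_additivePolynomial (r : ℕ) (a : ℕ → κ) (x : κ) :
    (additivePolynomial (Fintype.card Fq) r a).eval x = additivePoly Fq r a x := by
  simp [additivePolynomial, additivePoly_apply, eval_finsetSum]

theorem coeff_additivePolynomial {q r : ℕ} (hq : 2 ≤ q) (a : ℕ → κ) {i : ℕ} (hi : i ≤ r) :
    (additivePolynomial q r a).coeff (q ^ i) = a i := by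
  rw [additivePolynomial, finsetSum_coeff, Finset.sum_eq_single i]
  · simp
  · intro j _ hj
    rw [coeff_C_mul_X_pow, if_neg fun h => hj (Nat.pow_right_injective hq h).symm]
  · intro h; exact absurd (Finset.mem_range.2 (Nat.lt_succ_iff.2 hi)) h

theorem monic_additivePolynomial {q r : ℕ} (hq : 2 ≤ q) {a : ℕ → κ} (ha : a r = 1) :
    (additivePolynomial q r a).Monic := by
  rw [additivePolynomial, Finset.sum_range_succ, ha, C_1, one_mul, add_comm]
  refine monic_X_pow_add ((degree_sum_le _ _).trans_lt ?_)
  rw [Finset.sup_lt_iff (WithBot.bot_lt_coe _)]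
  intro i hi
  refine (degree_C_mul_X_pow_le _ _).trans_lt ?_
  exact_mod_cast Nat.pow_lt_pow_right (by omega) (Finset.mem_range.1 hi)

theorem map_additivePolynomial {L : Type*} [Field L] (f : κ →+* L) (q r : ℕ) (a : ℕ → κ) :
    (additivePolynomial q r a).map f = additivePolynomial q r (f ∘ a) := by
  simp [additivePolynomial, Polynomial.map_sum]

/-- Over an algebraically closed field, a point is as near to its nearest root as its image is
small. -/
theorem exists_root_valuation_le [IsAlgClosed κ] {Γ : Type*}
    [LinearOrderedCommGroupWithZero Γ] (v : Valuation κ Γ) {r : ℕ} {a : ℕ → κ} (ha : a r = 1)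
    (y : κ) :
    ∃ ρ, additivePoly Fq r a ρ = 0 ∧ ∀ i ≤ r,
      v (a i) * v (y - ρ) ^ Fintype.card Fq ^ i ≤ v (additivePoly Fq r a y) := by
  classical
  have hq : 2 ≤ Fintype.card Fq := Fintype.one_lt_card
  set P := additivePolynomial (Fintype.card Fq) r a with hP
  have hmon : P.Monic := monic_additivePolynomial hq ha
  have hroot : ∀ ρ, ρ ∈ P.roots ↔ additivePoly Fq r a ρ = 0 := fun ρ => by
    rw [mem_roots hmon.ne_zero, IsRoot, hP, eval_additivePolynomial]
  have h0 : (0 : κ) ∈ P.roots.toFinset := by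
    rw [Multiset.mem_toFinset, hroot, map_zero]
  obtain ⟨ρ₀, hρ₀, hmin⟩ := P.roots.toFinset.exists_min_image (fun ρ => v (y - ρ)) ⟨0, h0⟩
  rw [Multiset.mem_toFinset, hroot] at hρ₀
  refine ⟨ρ₀, hρ₀, fun i hi => ?_⟩
  -- The roots form a group, so translating by the nearest root `ρ₀` makes `0` the nearest root to
  -- `y - ρ₀`.
  have hz : ∀ ρ ∈ P.roots, v (y - ρ₀) ≤ v (y - ρ₀ - ρ) := fun ρ hρ => by
    rw [sub_sub]
    refine hmin _ ?_
    rw [Multiset.mem_toFinset, hroot, map_add, hρ₀, (hroot ρ).1 hρ, add_zero]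
  have hprod : P = (P.roots.map fun ρ => X - C ρ).prod :=
    (IsAlgClosed.splits P).eq_prod_roots_of_monic hmon
  have hcomp : P.comp (C (y - ρ₀) * X) = (P.roots.map fun ρ => C (y - ρ₀) * X - C ρ).prod := by
    conv_lhs => rw [hprod, multiset_prod_comp, Multiset.map_map]
    simp
  have hev : additivePoly Fq r a y = (P.roots.map fun ρ => y - ρ₀ - ρ).prod := by
    have : additivePoly Fq r a y = P.eval (y - ρ₀) := by
      rw [hP, eval_additivePolynomial, map_sub, hρ₀, sub_zero]
    rw [this]
    conv_lhs => rw [hprod, eval_multiset_prod, Multiset.map_map]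
    simp
  have hle := valuation_coeff_multiset_prod_le v hz (Fintype.card Fq ^ i)
  rw [← hcomp, comp_C_mul_X_coeff, hP, coeff_additivePolynomial hq a hi, map_mul, map_pow] at hle
  rw [hev, map_multiset_prod, Multiset.map_map]
  exact hle

/-- If `f(y)` and `f(y')` are small compared to a coefficient `aᵢ` of the monic additive
polynomial `f`, and `y` and `y'` are near the same root of `f`, then `y` is near `y'`. -/
theorem exists_nearRoot (O : ValuationSubring κ) {r : ℕ} {a : ℕ → κ} (ha : a r = 1)
    {i : ℕ} (hi : i ≤ r) (hai : a i ∉ O) :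
    ∃ ρ : κ → {x : AlgebraicClosure κ //
        x ∈ (additivePolynomial (Fintype.card Fq) r a).rootSet (AlgebraicClosure κ)},
      ∀ y y', O.valuation (additivePoly Fq r a y) ^ 2 ≤ O.valuation (a i) →
        O.valuation (additivePoly Fq r a y') ^ 2 ≤ O.valuation (a i) → ρ y = ρ y' →
        O.valuation (a i) * O.valuation (y - y') ^ (2 * Fintype.card Fq ^ r) ≤ 1 := by
  have hq : 2 ≤ Fintype.card Fq := Fintype.one_lt_card
  set Ω := AlgebraicClosure κ
  obtain ⟨O', hO'⟩ := O.exists_comap_eq (algebraMap κ Ω)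
  have hmono : ∀ x y : κ, O.valuation x ≤ O.valuation y ↔
      O'.valuation (algebraMap κ Ω x) ≤ O'.valuation (algebraMap κ Ω y) :=
    ValuationSubring.valuation_le_iff_of_comap_eq hO'
  have hf : ∀ y : κ, algebraMap κ Ω (additivePoly Fq r a y) =
      additivePoly Fq r (algebraMap κ Ω ∘ a) (algebraMap κ Ω y) := fun y => by
    simp [additivePoly_apply, map_sum]
  have ha' : (algebraMap κ Ω ∘ a) r = 1 := by simp [ha]
  choose ρ hρ hle using fun y : κ =>
    exists_root_valuation_le (Fq := Fq) O'.valuation ha' (algebraMap κ Ω y)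
  refine ⟨fun y => ⟨ρ y, ?_⟩, fun y y' hy hy' hyy' => ?_⟩
  · rw [mem_rootSet', map_additivePolynomial, aeval_def, eval₂_eq_eval_map,
      map_additivePolynomial]
    exact ⟨(monic_additivePolynomial hq ha').ne_zero,
      (eval_additivePolynomial (Fq := Fq) r _ _).trans (hρ y)⟩
  set A := O'.valuation (algebraMap κ Ω (a i)) with hA
  have hA1 : 1 < A := by
    rw [hA, ← O'.valuation.map_one, ← map_one (algebraMap κ Ω), ← not_le, ← hmono]
    simpa [ValuationSubring.valuation_le_one_iff] using hai
  have hA0 : A ≠ 0 := (zero_lt_one.trans hA1).ne'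
  -- Squaring the bound `A * Z ^ (q ^ i) ≤ |f(y)|` leaves one spare factor `A`. This forces `Z ≤ 1`,
  -- so the exponent may be raised from `q ^ i` to `q ^ r`, which no longer depends on `i`.
  have key : ∀ y, O.valuation (additivePoly Fq r a y) ^ 2 ≤ O.valuation (a i) →
      A * O'.valuation (algebraMap κ Ω y - ρ y) ^ (2 * Fintype.card Fq ^ r) ≤ 1 := by
    intro y hy
    rw [← map_pow, hmono, map_pow, map_pow, hf, ← hA] at hy
    have h := hle y i hi
    set Z := O'.valuation (algebraMap κ Ω y - ρ y)
    have h2 : A * (A * Z ^ (2 * Fintype.card Fq ^ i)) ≤ A * 1 := by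
      calc A * (A * Z ^ (2 * Fintype.card Fq ^ i)) = (A * Z ^ Fintype.card Fq ^ i) ^ 2 := by
            rw [mul_pow, mul_comm 2, pow_mul, sq A, mul_assoc]
        _ ≤ _ := pow_le_pow_left' h 2
        _ ≤ A * 1 := by rw [mul_one]; exact hy
    have h3 : A * Z ^ (2 * Fintype.card Fq ^ i) ≤ 1 :=
      (mul_le_mul_iff_right₀ (zero_lt_iff.2 hA0)).1 h2
    have hZ : Z ≤ 1 := by
      by_contra! hZ
      exact absurd h3 (not_le.2 (one_lt_mul_of_lt_of_le hA1 (one_le_pow₀ hZ.le)))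
    refine le_trans (mul_le_mul_right ?_ A) h3
    exact pow_le_pow_right_of_le_one' hZ
      (Nat.mul_le_mul_left _ (Nat.pow_le_pow_right (by omega) hi))
  have hfin : A * O'.valuation (algebraMap κ Ω (y - y')) ^ (2 * Fintype.card Fq ^ r) ≤ 1 := by
    have hd : algebraMap κ Ω (y - y') =
        (algebraMap κ Ω y - ρ y) - (algebraMap κ Ω y' - ρ y') := by
      rw [show ρ y = ρ y' from congrArg Subtype.val hyy', map_sub, sub_sub_sub_cancel_right]
    rw [hd]
    rcases le_max_iff.1 (O'.valuation.map_sub (algebraMap κ Ω y - ρ y)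
      (algebraMap κ Ω y' - ρ y')) with h | h
    · exact (mul_le_mul_right (pow_le_pow_left' h _) A).trans (key y hy)
    · exact (mul_le_mul_right (pow_le_pow_left' h _) A).trans (key y' hy')
  rw [← map_pow, ← map_mul, ← O.valuation.map_one, hmono]
  simpa using hfin

end NearRoot

/-! ### Valuation rings of a field of transcendence degree one -/

section ValuationRings

open scoped IntermediateField.algebraAdjoinAdjoin

theorem ValuationSubring.mem_of_isIntegral {R K : Type*} [CommRing R] [Field K] [Algebra R K]
    {O : ValuationSubring K} (hO : ∀ c : R, algebraMap R K c ∈ O) {x : K} (hx : IsIntegral R x) :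
    x ∈ O := by
  obtain ⟨p, hp, he⟩ := hx
  have hx' : IsIntegral O x := by
    refine ⟨p.map ((algebraMap R K).codRestrict O.toSubring hO), hp.map _, ?_⟩
    rw [Polynomial.eval₂_map]
    exact he
  obtain ⟨y, rfl⟩ := IsIntegrallyClosed.isIntegral_iff.1 hx'
  exact y.2

theorem isIntegral_of_forall_mem_valuationSubring {R K : Type*} [CommRing R] [Field K]
    [Algebra R K] {x : K}
    (hx : ∀ O : ValuationSubring K, (∀ c : R, algebraMap R K c ∈ O) → x ∈ O) : IsIntegral R x := by
  have h : x ∈ ⨅ V : {V : ValuationSubring K //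
      ((algebraMap R K).range : Set K) ⊆ V.toSubring}, V.1.toSubring := by
    rw [Subring.mem_iInf]
    exact fun V => hx V.1 fun c => V.2 ⟨c, rfl⟩
  rw [iInf_valuationSubring_superset] at h
  obtain ⟨p, hp, he⟩ := (mem_integralClosure_iff _ _).1 (Subalgebra.mem_toSubring.1 h)
  have hlift : p.map (algebraMap _ K) ∈ Polynomial.lifts (algebraMap R K) := by
    rw [Polynomial.lifts_iff_coeff_lifts]
    intro n
    rw [Polynomial.coeff_map]
    exact (Subring.closure_eq (algebraMap R K).range).le (p.coeff n).2
  obtain ⟨P, hP, -, hPm⟩ := Polynomial.lifts_and_natDegree_eq_and_monic hlift (hp.map _)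
  refine ⟨P, hPm, ?_⟩
  rw [← Polynomial.eval_map, hP, Polynomial.eval_map]
  exact he

variable {E κ : Type*} [Field E] [Field κ] [Algebra E κ]

theorem isAlgebraic_adjoin_singleton_of_trdeg_le_one (h : Algebra.trdeg E κ ≤ 1) {x : κ}
    (hx : Transcendental E x) : Algebra.IsAlgebraic (Algebra.adjoin E {x}) κ := by
  have hi : AlgebraicIndependent E ![x] := algebraicIndependent_iff_transcendental.2 hx
  have hb := hi.isTranscendenceBasis_of_lift_trdeg_le_of_finite (by simpa using h)
  have := hb.isAlgebraic
  rwa [Matrix.range_cons, Matrix.range_empty, Set.union_empty] at this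

theorem ValuationSubring.transcendental_of_notMem {O : ValuationSubring κ}
    (hO : ∀ c : E, algebraMap E κ c ∈ O) {x : κ} (hx : x ∉ O) : Transcendental E x :=
  fun h => hx (ValuationSubring.mem_of_isIntegral hO h.isIntegral)

theorem ValuationSubring.aeval_mem {O : ValuationSubring κ}
    (hO : ∀ c : E, algebraMap E κ c ∈ O) {x : κ} (hx : x ∈ O) (P : Polynomial E) :
    Polynomial.aeval x P ∈ O := by
  rw [Polynomial.aeval_eq_sum_range]
  refine sum_mem fun i _ => ?_
  rw [Algebra.smul_def]
  exact O.mul_mem _ _ (hO _) (pow_mem hx i)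

theorem ValuationSubring.adjoin_singleton_le {O : ValuationSubring κ}
    (hO : ∀ c : E, algebraMap E κ c ∈ O) {x : κ} (hx : x ∈ O) (c : Algebra.adjoin E {x}) :
    (c : κ) ∈ O := by
  obtain ⟨P, hP⟩ := (Algebra.adjoin_singleton_eq_range_aeval E x).le c.2
  exact hP ▸ ValuationSubring.aeval_mem hO hx P

/-- An element of a field of transcendence degree one is integral over `E[x]` up to a denominator
in `E[x]`. -/
theorem exists_aeval_mul_isIntegral (h : Algebra.trdeg E κ ≤ 1) {x : κ}
    (hx : Transcendental E x) (y : κ) :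
    ∃ P : Polynomial E, P ≠ 0 ∧
      IsIntegral (Algebra.adjoin E {x}) (Polynomial.aeval x P * y) := by
  have := isAlgebraic_adjoin_singleton_of_trdeg_le_one h hx
  obtain ⟨c, hc0, hc⟩ :=
    (Algebra.IsAlgebraic.isAlgebraic (R := Algebra.adjoin E {x}) y).exists_integral_multiple
  obtain ⟨c, hc'⟩ := c
  have hc'' := hc'
  rw [Algebra.adjoin_singleton_eq_range_aeval] at hc''
  obtain ⟨P, hP⟩ := hc''
  refine ⟨P, ?_, ?_⟩
  · rintro rfl
    exact hc0 (Subtype.ext (by simpa using hP.symm))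
  · have h2 : Polynomial.aeval x P = c := hP
    rw [h2]
    exact hc

theorem ValuationSubring.one_lt_valuation_iff {O : ValuationSubring κ} {x : κ} :
    1 < O.valuation x ↔ x ∉ O := by
  rw [← not_le, ValuationSubring.valuation_le_one_iff]

/-- The valuation rings of `κ` over `E` that do not contain `a` are uniformly archimedean. -/
theorem exists_valuation_le_pow (h : Algebra.trdeg E κ ≤ 1) {a : κ} (ha : Transcendental E a)
    (y : κ) : ∃ M : ℕ, ∀ O : ValuationSubring κ, (∀ c : E, algebraMap E κ c ∈ O) → a ∉ O →
      O.valuation y ≤ O.valuation a ^ M := by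
  have ha0 : a ≠ 0 := by rintro rfl; exact ha (isAlgebraic_zero)
  have hb : Transcendental E a⁻¹ := fun hb => ha (by simpa using hb.inv)
  -- A multiple `P(a⁻¹) y` is integral over `E[a⁻¹]`. As `a⁻¹` is in the maximal ideal of every ring
  -- in question, the part of `P` prime to `X` is a unit there, and the order of `P` at zero is a
  -- bound independent of the ring.
  obtain ⟨P, hP0, hP⟩ := exists_aeval_mul_isIntegral h hb y
  obtain ⟨Q, hQ, hQ0⟩ := Polynomial.exists_eq_pow_rootMultiplicity_mul_and_not_dvd P hP0 0
  rw [Polynomial.C_0, sub_zero] at hQ hQ0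
  refine ⟨P.rootMultiplicity 0, fun O hO haO => ?_⟩
  have hbO : a⁻¹ ∈ O := (O.mem_or_inv_mem a).resolve_left haO
  have hb1 : O.valuation a⁻¹ < 1 := by
    rw [map_inv₀]
    exact inv_lt_one_of_one_lt₀ (ValuationSubring.one_lt_valuation_iff.2 haO)
  have hQ1 : O.valuation (Polynomial.aeval a⁻¹ Q) = 1 := by
    rw [Polynomial.X_dvd_iff] at hQ0
    have hsplit := Polynomial.divX_mul_X_add Q
    have h1 : O.valuation (algebraMap E κ (Q.coeff 0)) = 1 := by
      refine le_antisymm ((ValuationSubring.valuation_le_one_iff _ _).2 (hO _)) ?_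
      have h2 := (ValuationSubring.valuation_le_one_iff _ _).2 (hO (Q.coeff 0)⁻¹)
      rw [map_inv₀, map_inv₀] at h2
      exact (inv_le_one₀ (zero_lt_iff.2 (by simpa using hQ0))).1 h2
    rw [← hsplit, map_add, map_mul, Polynomial.aeval_X, Polynomial.aeval_C,
      Valuation.map_add_eq_of_lt_right, h1]
    rw [h1, map_mul]
    exact (mul_le_of_le_one_left' ((ValuationSubring.valuation_le_one_iff _ _).2
      (ValuationSubring.aeval_mem hO hbO _))).trans_lt hb1
  have hint := (ValuationSubring.valuation_le_one_iff _ _).2 (ValuationSubring.mem_of_isIntegral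
    (O := O) (ValuationSubring.adjoin_singleton_le hO hbO) hP)
  have hPv : O.valuation (Polynomial.aeval a⁻¹ P) =
      (O.valuation a ^ P.rootMultiplicity 0)⁻¹ := by
    conv_lhs => rw [hQ, map_mul, map_mul, hQ1, mul_one, map_pow, Polynomial.aeval_X, map_pow,
      map_inv₀, inv_pow]
  rw [map_mul, hPv] at hint
  have hpos : 0 < O.valuation a ^ P.rootMultiplicity 0 :=
    zero_lt_iff.2 (pow_ne_zero _ ((Valuation.ne_zero_iff _).2 ha0))
  rwa [inv_mul_le_one₀ hpos] at hint

/-- The archimedean bound for `x⁻¹` gives `v y ≤ (v x)⁻¹ ^ M`, so `M + 1` factors `v x` suffice; if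
`x⁻¹` is algebraic over `E`, no ring qualifies. -/
theorem exists_valuation_pow_mul_lt_one (h : Algebra.trdeg E κ ≤ 1) (x y : κ) :
    ∃ n₀ : ℕ, ∀ O : ValuationSubring κ, (∀ c : E, algebraMap E κ c ∈ O) → O.valuation x < 1 →
      ∀ n ≥ n₀, O.valuation x ^ n * O.valuation y < 1 := by
  rcases eq_or_ne x 0 with rfl | hx0
  · exact ⟨1, fun O _ _ n hn => by rw [map_zero, zero_pow (by omega), zero_mul]; exact zero_lt_one⟩
  have hiff : ∀ O : ValuationSubring κ, O.valuation x < 1 → x⁻¹ ∉ O := fun O hO => by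
    rw [← ValuationSubring.one_lt_valuation_iff, map_inv₀]
    exact (one_lt_inv₀ (zero_lt_iff.2 ((Valuation.ne_zero_iff _).2 hx0))).2 hO
  by_cases ht : Transcendental E x⁻¹
  · obtain ⟨M, hM⟩ := exists_valuation_le_pow h ht y
    refine ⟨M + 1, fun O hO hx n hn => ?_⟩
    have h1 := hM O hO (hiff O hx)
    have hpos : 0 < O.valuation x := zero_lt_iff.2 ((Valuation.ne_zero_iff _).2 hx0)
    calc O.valuation x ^ n * O.valuation y
        ≤ O.valuation x ^ (M + 1) * O.valuation x⁻¹ ^ M :=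
          mul_le_mul' (pow_le_pow_right_of_le_one' hx.le hn) h1
      _ = O.valuation x := by
          rw [map_inv₀, pow_succ, mul_right_comm, ← mul_pow, mul_inv_cancel₀ hpos.ne', one_pow,
            one_mul]
      _ < 1 := hx
  · exact ⟨0, fun O hO hx =>
      absurd (ValuationSubring.transcendental_of_notMem hO (hiff O hx)) ht⟩

/-- The archimedean bound excludes proper inclusions between such rings, so each of the two has an
element outside the other; their quotient separates the rings. -/
theorem exists_one_lt_valuation_lt_one (h : Algebra.trdeg E κ ≤ 1) {a : κ}
    {O O' : ValuationSubring κ} (hO : ∀ c : E, algebraMap E κ c ∈ O)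
    (hO' : ∀ c : E, algebraMap E κ c ∈ O') (ha : a ∉ O) (ha' : a ∉ O') (hne : O ≠ O') :
    ∃ x, 1 < O.valuation x ∧ O'.valuation x < 1 := by
  have key : ∀ V V' : ValuationSubring κ, (∀ c : E, algebraMap E κ c ∈ V') → a ∉ V → V' ≤ V →
      V ≤ V' := by
    intro V V' hV' haV hle x hx
    by_contra hxV'
    obtain ⟨M, hM⟩ := exists_valuation_le_pow h
      (ValuationSubring.transcendental_of_notMem hV' hxV') a
    have h1 := hM V' hV' hxV'
    have hx0 : x ≠ 0 := by rintro rfl; exact hxV' V'.zero_mem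
    rw [← map_pow, ValuationSubring.valuation_le_iff_div_mem _ _ (pow_ne_zero _ hx0)] at h1
    have h2 := mul_mem (hle h1) (pow_mem hx M)
    rw [div_mul_cancel₀ _ (pow_ne_zero _ hx0)] at h2
    exact haV h2
  have h1 : ¬ O' ≤ O := fun hle => hne (le_antisymm (key O O' hO' ha hle) hle)
  have h2 : ¬ O ≤ O' := fun hle => hne (le_antisymm hle (key O' O hO ha' hle))
  obtain ⟨x, hx, hxO⟩ := SetLike.not_le_iff_exists.1 h1
  obtain ⟨y, hy, hyO'⟩ := SetLike.not_le_iff_exists.1 h2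
  refine ⟨x / y, ?_, ?_⟩
  · have hy0 : y ≠ 0 := by rintro rfl; exact hyO' O'.zero_mem
    rw [map_div₀, one_lt_div₀ (zero_lt_iff.2 ((Valuation.ne_zero_iff _).2 hy0))]
    exact ((ValuationSubring.valuation_le_one_iff _ _).2 hy).trans_lt
      (ValuationSubring.one_lt_valuation_iff.2 hxO)
  · have h3 := ValuationSubring.one_lt_valuation_iff.2 hyO'
    rw [map_div₀, div_lt_one₀ (zero_lt_one.trans h3)]
    exact ((ValuationSubring.valuation_le_one_iff _ _).2 hx).trans_lt h3

/-- Weak approximation for the valuation rings of `κ` over `E` that do not contain `a`. -/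
theorem exists_one_lt_valuation_forall_lt_one (h : Algebra.trdeg E κ ≤ 1) {a : κ}
    {O : ValuationSubring κ} (hO : ∀ c : E, algebraMap E κ c ∈ O) (ha : a ∉ O)
    (s : Finset (ValuationSubring κ))
    (hs : ∀ V ∈ s, (∀ c : E, algebraMap E κ c ∈ V) ∧ a ∉ V ∧ O ≠ V) :
    ∃ x, 1 < O.valuation x ∧ ∀ V ∈ s, V.valuation x < 1 := by
  classical
  induction s using Finset.induction_on with
  | empty => exact ⟨a, ValuationSubring.one_lt_valuation_iff.2 ha, by simp⟩
  | insert W s _ ih =>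
    obtain ⟨x, hx, hxs⟩ := ih fun V hV => hs V (Finset.mem_insert_of_mem hV)
    obtain ⟨hW, haW, hOW⟩ := hs W (Finset.mem_insert_self _ _)
    have hs' := fun V hV => hs V (Finset.mem_insert_of_mem hV)
    obtain ⟨y, hy, hyW⟩ := exists_one_lt_valuation_lt_one h hO hW ha haW hOW
    obtain ⟨n₀, hn₀⟩ := exists_valuation_pow_mul_lt_one h x y
    -- When `x` is large at `W` too, `x ^ n / (1 + x ^ n)` has value one at `O` and `W` and is small
    -- at the rings of `s`, so it can correct `y`. Otherwise a power of `x` already does.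
    rcases lt_or_ge 1 (W.valuation x) with hxW | hxW
    · have hden : ∀ V : ValuationSubring κ, 1 < V.valuation x →
          V.valuation (x ^ (n₀ + 1) / (1 + x ^ (n₀ + 1))) = 1 := by
        intro V hV
        have h1 : 1 < V.valuation (x ^ (n₀ + 1)) := by
          rw [map_pow]; exact one_lt_pow₀ hV (by omega)
        have h2 : V.valuation (1 + x ^ (n₀ + 1)) = V.valuation (x ^ (n₀ + 1)) :=
          Valuation.map_add_eq_of_lt_right _ (by rwa [Valuation.map_one])
        rw [map_div₀, h2, div_self (zero_lt_one.trans h1).ne']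
      refine ⟨x ^ (n₀ + 1) / (1 + x ^ (n₀ + 1)) * y, ?_, fun V hV => ?_⟩
      · rw [map_mul, hden O hx, one_mul]; exact hy
      · rcases Finset.mem_insert.1 hV with rfl | hV
        · rw [map_mul, hden V hxW, one_mul]; exact hyW
        · have hxV := hxs V hV
          have h1 : V.valuation (x ^ (n₀ + 1)) < 1 := by
            rw [map_pow]; exact pow_lt_one₀ zero_le hxV (by omega)
          have h2 : V.valuation (1 + x ^ (n₀ + 1)) = 1 := by
            rw [Valuation.map_add_eq_of_lt_left _ (by rwa [Valuation.map_one]), Valuation.map_one]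
          rw [map_mul, map_div₀, h2, div_one, map_pow]
          exact hn₀ V (hs' V hV).1 hxV _ (by omega)
    · refine ⟨x ^ (n₀) * y, ?_, fun V hV => ?_⟩
      · rw [map_mul, map_pow]
        exact one_lt_mul_of_le_of_lt (one_le_pow₀ hx.le) hy
      · rcases Finset.mem_insert.1 hV with rfl | hV
        · rw [map_mul, map_pow]
          exact (mul_le_of_le_one_left' (pow_le_one₀ zero_le hxW)).trans_lt hyW
        · rw [map_mul, map_pow]
          exact hn₀ V (hs' V hV).1 (hxs V hV) _ le_rfl

theorem ValuationSubring.valuation_aeval_eq {O : ValuationSubring κ}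
    (hO : ∀ c : E, algebraMap E κ c ∈ O) {a : κ} (ha : a ∉ O) {P : Polynomial E} (hP : P ≠ 0) :
    O.valuation (Polynomial.aeval a P) = O.valuation a ^ P.natDegree := by
  have ha1 := ValuationSubring.one_lt_valuation_iff.2 ha
  have hc : ∀ c : E, c ≠ 0 → O.valuation (algebraMap E κ c) = 1 := by
    intro c hc
    refine le_antisymm ((ValuationSubring.valuation_le_one_iff _ _).2 (hO _)) ?_
    have h2 := (ValuationSubring.valuation_le_one_iff _ _).2 (hO c⁻¹)
    rw [map_inv₀, map_inv₀] at h2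
    exact (inv_le_one₀ (zero_lt_iff.2 (by simpa using hc))).1 h2
  have htop : O.valuation (P.coeff P.natDegree • a ^ P.natDegree) =
      O.valuation a ^ P.natDegree := by
    rw [Algebra.smul_def, map_mul, hc _ (by simpa using hP), one_mul, map_pow]
  rw [Polynomial.aeval_eq_sum_range, Finset.sum_range_succ, Valuation.map_add_eq_of_lt_right, htop]
  rw [htop]
  refine Valuation.map_sum_lt _ (pow_pos (zero_lt_one.trans ha1) _).ne' fun i hi => ?_
  rw [Algebra.smul_def, map_mul, map_pow]
  exact (mul_le_of_le_one_left' ((ValuationSubring.valuation_le_one_iff _ _).2 (hO _))).trans_lt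
    (pow_lt_pow_right₀ ha1 (Finset.mem_range.1 hi))

/-- Only finitely many valuation rings over `E` do not contain a given element, in a field `κ` of
transcendence degree one that is radicial over a finitely generated field. -/
theorem finite_setOf_notMem_valuationSubring (h : Algebra.trdeg E κ ≤ 1) (G : Finset κ)
    (hG : ∀ x : κ, ∃ e ≠ 0, x ^ e ∈ Subfield.closure (G : Set κ)) (a : κ) :
    {O : ValuationSubring κ | (∀ c : E, algebraMap E κ c ∈ O) ∧ a ∉ O}.Finite := by
  classical
  by_contra hinf
  obtain ⟨O₁, hO₁⟩ := Set.Infinite.nonempty hinf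
  have ha : Transcendental E a := ValuationSubring.transcendental_of_notMem hO₁.1 hO₁.2
  have halg := isAlgebraic_adjoin_singleton_of_trdeg_le_one h ha
  let L := IntermediateField.adjoin E {a}
  let F := IntermediateField.adjoin L (G : Set κ)
  have hLalg : Algebra.IsAlgebraic L κ := by
    have hi : AlgebraicIndependent E ![a] := algebraicIndependent_iff_transcendental.2 ha
    have hb := hi.isTranscendenceBasis_of_lift_trdeg_le_of_finite (by simpa using h)
    have := hb.isAlgebraic_field
    rwa [Matrix.range_cons, Matrix.range_empty, Set.union_empty] at this
  have hfin : FiniteDimensional L F :=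
    IntermediateField.finiteDimensional_adjoin fun x _ => (hLalg.isAlgebraic x).isIntegral
  have hF : ∀ x : κ, ∃ e ≠ 0, x ^ e ∈ F := fun x => by
    obtain ⟨e, he, hx⟩ := hG x
    exact ⟨e, he, (Subfield.closure_le (t := F.toSubfield)).2
      (IntermediateField.subset_adjoin L _) hx⟩
  -- One ring more than `[F : E(a)]`: the separating elements, pushed into `F` by taking powers,
  -- will be linearly independent over `E(a)`.
  obtain ⟨s, hs, hcard⟩ := Set.Infinite.exists_subset_card_eq hinf (Module.finrank L F + 1)
  have hex : ∀ O : s, ∃ x ∈ F, 1 < O.1.valuation x ∧ ∀ V ∈ s, V ≠ O → V.valuation x < 1 := by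
    rintro ⟨O, hOs⟩
    obtain ⟨x, hx, hxV⟩ := exists_one_lt_valuation_forall_lt_one h (hs hOs).1 (hs hOs).2
      (s.erase O) fun V hV => ⟨(hs (Finset.mem_of_mem_erase hV)).1,
        (hs (Finset.mem_of_mem_erase hV)).2, (Finset.ne_of_mem_erase hV).symm⟩
    obtain ⟨e, he, hxF⟩ := hF x
    refine ⟨x ^ e, hxF, ?_, fun V hV hne => ?_⟩
    · rw [map_pow]; exact one_lt_pow₀ hx he
    · rw [map_pow]; exact pow_lt_one₀ zero_le (hxV V (Finset.mem_erase.2 ⟨hne, hV⟩)) he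
  choose x hxF hx1 hxlt using hex
  have hli : LinearIndependent (Algebra.adjoin E {a}) x := by
    rw [Fintype.linearIndependent_iff]
    intro g hg
    by_contra! hne
    have hpoly : ∀ O : s, ∃ P : Polynomial E, Polynomial.aeval a P = (g O : κ) := fun O =>
      (Algebra.adjoin_singleton_eq_range_aeval E a).le (g O).2
    choose P hP using hpoly
    have hP0 : ∀ O, g O ≠ 0 ↔ P O ≠ 0 := fun O => by
      rw [not_iff_not]
      constructor
      · intro h0
        by_contra hP'
        exact (transcendental_iff.1 ha) (P O) (by rw [hP, h0]; rfl) |> hP'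
      · intro h0
        refine Subtype.ext ?_
        rw [← hP, h0, map_zero]; rfl
    obtain ⟨i₀, hi₀⟩ := hne
    -- In a relation over `E[a]`, look at the ring whose coefficient has the largest degree in `a`:
    -- there its own term strictly dominates all the others.
    obtain ⟨i, hi, hmax⟩ := (Finset.univ.filter fun O => g O ≠ 0).exists_max_image
      (fun O => (P O).natDegree) ⟨i₀, by simpa using hi₀⟩
    have hi0 : P i ≠ 0 := (hP0 i).1 (Finset.mem_filter.1 hi).2
    have hiO := hs i.2
    have hai := ValuationSubring.one_lt_valuation_iff.2 hiO.2
    have hmain : i.1.valuation a ^ (P i).natDegree < i.1.valuation ((g i : κ) * x i) := by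
      rw [map_mul, ← hP, ValuationSubring.valuation_aeval_eq hiO.1 hiO.2 hi0]
      exact lt_mul_of_one_lt_right (pow_pos (zero_lt_one.trans hai) _) (hx1 i)
    have hrest : i.1.valuation (∑ j ∈ Finset.univ.erase i, (g j : κ) * x j) <
        i.1.valuation ((g i : κ) * x i) := by
      refine Valuation.map_sum_lt _ ((pow_pos (zero_lt_one.trans hai) _).trans hmain).ne'
        fun j hj => ?_
      by_cases hgj : g j = 0
      · rw [hgj]; simpa using (pow_pos (zero_lt_one.trans hai) _).trans hmain
      refine lt_of_le_of_lt ?_ hmain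
      rw [map_mul, ← hP, ValuationSubring.valuation_aeval_eq hiO.1 hiO.2 ((hP0 j).1 hgj)]
      have hle := hmax j (by simpa using hgj)
      have hne : (i : ValuationSubring κ) ≠ j := fun hij =>
        Finset.ne_of_mem_erase hj (Subtype.ext hij.symm)
      exact (mul_le_of_le_one_right' (hxlt j i i.2 hne).le).trans
        (pow_le_pow_right₀ hai.le hle)
    have hzero : (g i : κ) * x i + ∑ j ∈ Finset.univ.erase i, (g j : κ) * x j = 0 := by
      rw [Finset.add_sum_erase _ (fun j => (g j : κ) * x j) (Finset.mem_univ i)]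
      exact hg
    have := Valuation.map_add_eq_of_lt_left (i.1.valuation) hrest
    rw [hzero, map_zero] at this
    exact absurd this ((pow_pos (zero_lt_one.trans hai) _).trans hmain).ne
  have hliL : LinearIndependent L x :=
    (LinearIndependent.iff_fractionRing (Algebra.adjoin E {a}) L).1 hli
  have hliF : LinearIndependent L fun O => (⟨x O, hxF O⟩ : F) :=
    LinearIndependent.of_comp F.val.toLinearMap hliL
  have := hliF.fintype_card_le_finrank
  rw [Fintype.card_coe, hcard] at this
  omega

end ValuationRings

/-! ### Points of small height -/

section SmallPoints

open Polynomial

variable {κ : Type*} [Field κ]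

/-- The largest absolute value of a coefficient `a₀, …, aᵣ`. -/
noncomputable def coeffNorm (r : ℕ) (a : ℕ → κ) (O : ValuationSubring κ) : O.ValueGroup :=
  (Finset.range (r + 1)).sup' Finset.nonempty_range_add_one fun i => O.valuation (a i)

theorem le_coeffNorm {r : ℕ} (a : ℕ → κ) (O : ValuationSubring κ) {i : ℕ} (hi : i ≤ r) :
    O.valuation (a i) ≤ coeffNorm r a O :=
  Finset.le_sup' (fun i => O.valuation (a i)) (Finset.mem_range.2 (Nat.lt_succ_iff.2 hi))

theorem exists_coeffNorm_eq (r : ℕ) (a : ℕ → κ) (O : ValuationSubring κ) :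
    ∃ i ≤ r, coeffNorm r a O = O.valuation (a i) := by
  obtain ⟨i, hi, h⟩ := (Finset.range (r + 1)).exists_mem_eq_sup' Finset.nonempty_range_add_one
    fun i => O.valuation (a i)
  exact ⟨i, Nat.lt_succ_iff.1 (Finset.mem_range.1 hi), h⟩

variable {E : Type*} [Field E] [Algebra E κ]

theorem exists_valuation_le_coeffNorm_pow (h : Algebra.trdeg E κ ≤ 1) (r : ℕ) (a : ℕ → κ)
    (y : κ) : ∃ M : ℕ, ∀ O : ValuationSubring κ, (∀ c : E, algebraMap E κ c ∈ O) →
      1 < coeffNorm r a O → O.valuation y ≤ coeffNorm r a O ^ M := by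
  have hM : ∀ i, ∃ M : ℕ, ∀ O : ValuationSubring κ, (∀ c : E, algebraMap E κ c ∈ O) → a i ∉ O →
      O.valuation y ≤ O.valuation (a i) ^ M := fun i => by
    by_cases ht : Transcendental E (a i)
    · exact exists_valuation_le_pow h ht y
    · exact ⟨0, fun O hO hi => absurd (ValuationSubring.transcendental_of_notMem hO hi) ht⟩
  choose M hM using hM
  refine ⟨(Finset.range (r + 1)).sup M, fun O hO h1 => ?_⟩
  obtain ⟨i, hi, heq⟩ := exists_coeffNorm_eq r a O
  rw [heq] at h1 ⊢
  refine (hM i O hO (ValuationSubring.one_lt_valuation_iff.1 h1)).trans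
    (pow_le_pow_right₀ h1.le ?_)
  exact Finset.le_sup (f := M) (Finset.mem_range.2 (Nat.lt_succ_iff.2 hi))

theorem exists_forall_valuation_le_coeffNorm_pow (h : Algebra.trdeg E κ ≤ 1) (r : ℕ) (a : ℕ → κ)
    {ι : Type*} [Fintype ι] (y : ι → κ) :
    ∃ M : ℕ, ∀ i, ∀ O : ValuationSubring κ, (∀ c : E, algebraMap E κ c ∈ O) →
      1 < coeffNorm r a O → O.valuation (y i) ≤ coeffNorm r a O ^ M := by
  choose M hM using fun i => exists_valuation_le_coeffNorm_pow h r a (y i)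
  exact ⟨Finset.univ.sup M, fun i O hO h1 => (hM i O hO h1).trans
    (pow_le_pow_right₀ h1.le (Finset.le_sup (f := M) (Finset.mem_univ i)))⟩

/-- A common denominator for the places where all of `a₀, …, aᵣ` are integral. -/
theorem exists_common_denominator (h : Algebra.trdeg E κ ≤ 1) {r : ℕ} {a : ℕ → κ} {i₀ : ℕ}
    (hi₀ : i₀ ≤ r) (ht : Transcendental E (a i₀)) {ι : Type*} [Fintype ι] (y : ι → κ) :
    ∃ D : κ, D ≠ 0 ∧ ∀ O : ValuationSubring κ, (∀ c : E, algebraMap E κ c ∈ O) →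
      coeffNorm r a O ≤ 1 → D ∈ O ∧ ∀ i, D * y i ∈ O := by
  classical
  choose P hP0 hP using fun i => exists_aeval_mul_isIntegral h ht (y i)
  refine ⟨∏ i, aeval (a i₀) (P i), ?_, fun O hO h1 => ?_⟩
  · refine Finset.prod_ne_zero_iff.2 fun i _ h0 => hP0 i ?_
    exact (transcendental_iff.1 ht) _ h0
  · have ha : a i₀ ∈ O :=
      (ValuationSubring.valuation_le_one_iff _ _).1 ((le_coeffNorm a O hi₀).trans h1)
    refine ⟨prod_mem fun i _ => ValuationSubring.aeval_mem hO ha _, fun i => ?_⟩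
    rw [← Finset.mul_prod_erase _ _ (Finset.mem_univ i), mul_right_comm]
    exact mul_mem (ValuationSubring.mem_of_isIntegral
      (ValuationSubring.adjoin_singleton_le hO ha) (hP i))
      (prod_mem fun i _ => ValuationSubring.aeval_mem hO ha _)

variable (E) in
/-- The points `z` of small height for the additive polynomial `f = ∑ aᵢ X ^ (q ^ i)`: at the
valuation rings of `κ` over `E` that do not contain all coefficients of `f`, the value `f(z)` is
small, and `z` has a denominator for the other valuation rings that is small at the former. -/
def smallPoints (Fq : Type*) [Field Fq] [Fintype Fq] [Algebra Fq κ] (r : ℕ) (a : ℕ → κ) : Set κ :=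
  {z | (∀ O : ValuationSubring κ, (∀ c : E, algebraMap E κ c ∈ O) → 1 < coeffNorm r a O →
      O.valuation (additivePoly Fq r a z) ^ 2 ≤ coeffNorm r a O) ∧
    ∃ D ≠ 0, (∀ O : ValuationSubring κ, (∀ c : E, algebraMap E κ c ∈ O) →
      coeffNorm r a O ≤ 1 → D ∈ O ∧ D * z ∈ O) ∧
      ∀ O : ValuationSubring κ, (∀ c : E, algebraMap E κ c ∈ O) → 1 < coeffNorm r a O →
        O.valuation D ^ (8 * Fintype.card Fq ^ r) ≤ coeffNorm r a O}

variable {Fq : Type*} [Field Fq] [Fintype Fq] [Algebra Fq κ]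

theorem one_lt_coeffNorm_of_notMem {r : ℕ} {a : ℕ → κ} {O : ValuationSubring κ} {i : ℕ}
    (hi : i ≤ r) (h : a i ∉ O) : 1 < coeffNorm r a O :=
  (ValuationSubring.one_lt_valuation_iff.2 h).trans_le (le_coeffNorm a O hi)

/-- Recording the near root at each of the finitely many bad rings is injective on small points. If
`z` and `z'` had the same record, `D D' (z - z')` would be integral over `E`, hence algebraic, and
so would its inverse; but its value is below one at a bad ring, which exists because `a i₀` is
transcendental. This replaces the product formula. -/
theorem finite_smallPoints (h : Algebra.trdeg E κ ≤ 1) (G : Finset κ)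
    (hG : ∀ x : κ, ∃ e ≠ 0, x ^ e ∈ Subfield.closure (G : Set κ)) {r : ℕ} {a : ℕ → κ}
    (ha : a r = 1) {i₀ : ℕ} (hi₀ : i₀ ≤ r) (ht : Transcendental E (a i₀)) :
    (smallPoints E Fq r a).Finite := by
  have hqr : 0 < Fintype.card Fq ^ r := pow_pos Fintype.card_pos r
  let B := {O : ValuationSubring κ // (∀ c : E, algebraMap E κ c ∈ O) ∧ 1 < coeffNorm r a O}
  have hB : Finite B := by
    refine ((Set.Finite.biUnion (Finset.finite_toSet (Finset.range (r + 1))) fun i _ =>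
      finite_setOf_notMem_valuationSubring (E := E) h G hG (a i)).subset ?_).to_subtype
    rintro O ⟨hO, h1⟩
    obtain ⟨i, hi, heq⟩ := exists_coeffNorm_eq r a O
    rw [heq] at h1
    exact Set.mem_biUnion (Finset.mem_coe.2 (Finset.mem_range.2 (Nat.lt_succ_iff.2 hi)))
      ⟨hO, ValuationSubring.one_lt_valuation_iff.1 h1⟩
  have hρ : ∀ O : B, ∃ ρ : κ → {x : AlgebraicClosure κ //
        x ∈ (additivePolynomial (Fintype.card Fq) r a).rootSet (AlgebraicClosure κ)},
      ∀ y y', O.1.valuation (additivePoly Fq r a y) ^ 2 ≤ coeffNorm r a O.1 →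
        O.1.valuation (additivePoly Fq r a y') ^ 2 ≤ coeffNorm r a O.1 → ρ y = ρ y' →
        coeffNorm r a O.1 * O.1.valuation (y - y') ^ (2 * Fintype.card Fq ^ r) ≤ 1 := by
    rintro ⟨O, hO, h1⟩
    obtain ⟨i, hi, heq⟩ := exists_coeffNorm_eq r a O
    simp only [heq] at h1 ⊢
    exact exists_nearRoot O ha hi (ValuationSubring.one_lt_valuation_iff.1 h1)
  choose ρ hρ using hρ
  refine Set.finite_coe_iff.1 (Finite.of_injective
    (fun (z : smallPoints E Fq r a) (O : B) => ρ O z) ?_)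
  rintro ⟨z, hz, D, hD0, hDg, hDb⟩ ⟨z', hz', D', hD0', hDg', hDb'⟩ heq
  refine Subtype.ext ?_
  by_contra hne
  have hd : D * D' * (z - z') ≠ 0 := mul_ne_zero (mul_ne_zero hD0 hD0') (sub_ne_zero.2 hne)
  have hbad : ∀ O : ValuationSubring κ, (∀ c : E, algebraMap E κ c ∈ O) →
      1 < coeffNorm r a O → O.valuation (D * D' * (z - z')) < 1 := by
    intro O hO h1
    have h2 := hρ ⟨O, hO, h1⟩ z z' (hz O hO h1) (hz' O hO h1) (congrFun heq ⟨O, hO, h1⟩)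
    have h3 := hDb O hO h1
    have h4 := hDb' O hO h1
    change coeffNorm r a O * O.valuation (z - z') ^ (2 * Fintype.card Fq ^ r) ≤ 1 at h2
    set A := coeffNorm r a O
    set Q := Fintype.card Fq ^ r
    by_contra! hge
    -- The exponent `8 * Q` is four times that of the near-root bound: proximity gains `A ^ 4`,
    -- while the two denominators lose only `A ^ 2`.
    have h5 : O.valuation (D * D' * (z - z')) ^ (8 * Q) * A ^ 4 ≤ A * A := by
      calc O.valuation (D * D' * (z - z')) ^ (8 * Q) * A ^ 4
          = O.valuation D ^ (8 * Q) * O.valuation D' ^ (8 * Q) *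
              (A * O.valuation (z - z') ^ (2 * Q)) ^ 4 := by
            rw [map_mul, map_mul, mul_pow, mul_pow, mul_pow A, ← pow_mul (O.valuation (z - z')),
              mul_assoc, mul_assoc, mul_assoc, mul_comm (A ^ 4),
              show 2 * Q * 4 = 8 * Q by ring]
        _ ≤ A * A * 1 := mul_le_mul' (mul_le_mul' h3 h4) (pow_le_one' h2 4)
        _ = A * A := mul_one _
    have h6 : A ^ 4 ≤ A ^ 2 := by
      rw [sq]
      exact (le_mul_of_one_le_left' (one_le_pow_of_one_le' hge _)).trans h5
    exact absurd h6 (not_le.2 (pow_lt_pow_right₀ h1 (by norm_num)))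
  have hint : IsIntegral E (D * D' * (z - z')) := by
    refine isIntegral_of_forall_mem_valuationSubring fun O hO => ?_
    rcases le_or_gt (coeffNorm r a O) 1 with h1 | h1
    · have h2 := hDg O hO h1
      have h3 := hDg' O hO h1
      have h4 : D * D' * (z - z') = D' * (D * z) - D * (D' * z') := by ring
      rw [h4]
      exact sub_mem (mul_mem h3.1 h2.2) (mul_mem h2.1 h3.2)
    · exact (ValuationSubring.valuation_le_one_iff _ _).1 (hbad O hO h1).le
  obtain ⟨O, hO, hOa⟩ : ∃ O : ValuationSubring κ, (∀ c : E, algebraMap E κ c ∈ O) ∧ a i₀ ∉ O := by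
    by_contra! hall
    exact ht (isIntegral_of_forall_mem_valuationSubring hall).isAlgebraic
  have hinv := (ValuationSubring.valuation_le_one_iff O _).2 (ValuationSubring.mem_of_isIntegral hO
    hint.isAlgebraic.inv.isIntegral)
  rw [map_inv₀, inv_le_one₀ (zero_lt_iff.2 ((Valuation.ne_zero_iff _).2 hd))] at hinv
  exact absurd hinv (not_le.2 (hbad O hO (one_lt_coeffNorm_of_notMem hi₀ hOa)))

theorem valuation_sum_aeval_le {Γ : Type*} [LinearOrderedCommGroupWithZero Γ]
    (v : Valuation κ Γ) {r : ℕ} {a : ℕ → κ} (ha : a r = 1) {C : Γ} (h1 : 1 ≤ C)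
    (hC : ∀ i ≤ r, v (a i) ≤ C) {ι : Type*} [Fintype ι] {x : ι → κ} (hx : ∀ i, v (x i) ≤ C)
    {ε : ι → Fq[X]} {n : ℕ} (hε : ∀ i, (ε i).natDegree ≤ n) :
    v (∑ i, aeval (additivePoly Fq r a) (ε i) (x i)) ≤ C ^ Fintype.card Fq ^ (r * n) :=
  v.map_sum_le fun i _ => (valuation_aeval_additivePoly_le v ha h1 hC (hx i) (ε i)).trans
    (pow_le_pow_right₀ h1 (Nat.pow_le_pow_right Fintype.card_pos (Nat.mul_le_mul_left _ (hε i))))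

/-- A point that is a small linear combination of given points, up to division, is small. -/
theorem exists_forall_mem_smallPoints (h : Algebra.trdeg E κ ≤ 1)
    (hperf : ∀ (x : κ) (n : ℕ), ∃ y, y ^ Fintype.card Fq ^ n = x) {r : ℕ} (hr : 2 ≤ r)
    {a : ℕ → κ} (ha : a r = 1) {i₀ : ℕ} (hi₀ : i₀ ≤ r) (ht : Transcendental E (a i₀))
    {ι : Type*} [Fintype ι] (x : ι → κ) :
    ∃ m : ℕ, ∀ (G : Fq[X]) (ε : ι → Fq[X]) (z : κ), G ≠ 0 →
      (∀ i, (ε i).natDegree + m ≤ G.natDegree) → m ≤ G.natDegree →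
      aeval (additivePoly Fq r a) G z = ∑ i, aeval (additivePoly Fq r a) (ε i) (x i) →
      z ∈ smallPoints E Fq r a := by
  have hq : 2 ≤ Fintype.card Fq := Fintype.one_lt_card
  set f := additivePoly Fq r a with hf
  obtain ⟨D₀, hD₀, hD₀g⟩ := exists_common_denominator h hi₀ ht x
  obtain ⟨M₁, hM₁⟩ := exists_forall_valuation_le_coeffNorm_pow h r a fun i => f (x i)
  obtain ⟨M₂, hM₂⟩ := exists_valuation_le_coeffNorm_pow h r a D₀
  set M := M₁ + M₂ + 1 with hM
  set k := 8 * Fintype.card Fq ^ r with hk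
  have hk2 : 2 ≤ k := by
    have := pow_pos (show 0 < Fintype.card Fq by omega) r
    omega
  -- Only `k * M ≤ q ^ (r * m)` matters. It serves the bound on `f z`, which needs `2 * M`, and the
  -- one on the denominator, where `k` is the exponent in `smallPoints`.
  set m := k * M
  have hm : k * M ≤ Fintype.card Fq ^ (r * m) := by
    refine (Nat.lt_pow_self hq).le.trans (Nat.pow_le_pow_right (by omega) ?_)
    exact Nat.le_mul_of_pos_left _ (by omega)
  have hqm : Fintype.card Fq ^ (r * m) ≠ 0 := (pow_pos (by omega) _).ne'
  refine ⟨m, fun G ε z hG hε hmG hz => ?_⟩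
  have hexp : Fintype.card Fq ^ (r * G.natDegree) =
      Fintype.card Fq ^ (r * m) * Fintype.card Fq ^ (r * (G.natDegree - m)) := by
    rw [← pow_add, ← mul_add, Nat.add_sub_cancel' hmG]
  have hε' : ∀ i, (ε i).natDegree ≤ G.natDegree - m := fun i => Nat.le_sub_of_add_le (hε i)
  have hQ0 : Fintype.card Fq ^ (r * (G.natDegree - m)) ≠ 0 := (pow_pos (by omega) _).ne'
  refine ⟨fun O hO h1 => ?_, ?_⟩
  -- If `f z` were large, it would dominate the coefficients, and applying `G` would raise its value
  -- exactly to the power `q ^ (r * deg G)`. The combination of the `f (x i)` grows only with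
  -- exponent `q ^ (r * (deg G - m))`. Taking roots contradicts the choice of `m`.
  · by_contra! hlt
    have hA1 : 1 ≤ coeffNorm r a O := h1.le
    have hfz : 1 < O.valuation (f z) := by
      by_contra! hle
      exact absurd (h1.trans hlt) (not_lt.2 (pow_le_one' hle 2))
    have hcomm : aeval f G (f z) = ∑ i, aeval f (ε i) (f (x i)) := by
      have hc : ∀ (P : Fq[X]) (y : κ), aeval f P (f y) = f (aeval f P y) := fun P y => by
        have h2 : aeval f (P * X) = aeval f (X * P) := by rw [mul_comm]
        rw [map_mul, map_mul, aeval_X] at h2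
        exact LinearMap.congr_fun h2 y
      rw [hc, hz, map_sum]
      exact Finset.sum_congr rfl fun i _ => (hc _ _).symm
    have h2 := valuation_aeval_additivePoly_eq O.valuation hr ha hfz
      (fun i hi => (le_coeffNorm a O hi.le).trans_lt hlt) hG
    have hC1 : 1 ≤ coeffNorm r a O ^ M := one_le_pow_of_one_le' hA1 _
    have h3 := valuation_sum_aeval_le (Fq := Fq) O.valuation ha hC1
      (fun i hi => (le_coeffNorm a O hi).trans (le_self_pow₀ hA1 (by omega)))
      (fun i => (hM₁ i O hO h1).trans (pow_le_pow_right₀ hA1 (by omega))) hε'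
    rw [← hf, ← hcomm, h2, hexp, pow_mul, pow_le_pow_iff_left₀ zero_le zero_le hQ0] at h3
    refine absurd h3 (not_le.2 ?_)
    calc coeffNorm r a O ^ M < (O.valuation (f z) ^ 2) ^ M :=
          pow_lt_pow_left₀ hlt zero_le (by omega)
      _ = O.valuation (f z) ^ (2 * M) := by rw [pow_mul]
      _ ≤ _ := pow_le_pow_right₀ hfz.le ((Nat.mul_le_mul_right M hk2).trans hm)
  -- The same comparison at a good ring shows that the `q ^ (r * m)`-th power of `z` has denominator
  -- `D₀`, so the corresponding root of `D₀` is a denominator of `z`, and its value at the bad rings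
  -- is close to one.
  · obtain ⟨D, hD⟩ := hperf D₀ (r * m)
    have hD0 : D ≠ 0 := by
      rintro rfl
      exact hD₀ (by rw [← hD, zero_pow hqm])
    refine ⟨D, hD0, fun O hO h1 => ?_, fun O hO h1 => ?_⟩
    · obtain ⟨hDO, hDx⟩ := hD₀g O hO h1
      have hDO' : O.valuation D ≤ 1 := by
        rw [← pow_le_one_iff hqm, ← map_pow, hD]
        exact (ValuationSubring.valuation_le_one_iff _ _).2 hDO
      refine ⟨(ValuationSubring.valuation_le_one_iff _ _).1 hDO', ?_⟩
      rw [← ValuationSubring.valuation_le_one_iff, map_mul]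
      rcases le_or_gt (O.valuation z) 1 with hz1 | hz1
      · exact mul_le_one' hDO' hz1
      have hvpos : 0 < O.valuation D₀ := zero_lt_iff.2 ((Valuation.ne_zero_iff _).2 hD₀)
      have hC1 : 1 ≤ (O.valuation D₀)⁻¹ :=
        (one_le_inv₀ hvpos).2 ((ValuationSubring.valuation_le_one_iff _ _).2 hDO)
      have h2 := valuation_aeval_additivePoly_eq O.valuation hr ha hz1
        (fun i hi => ((le_coeffNorm a O hi.le).trans h1).trans_lt (one_lt_pow₀ hz1 two_ne_zero)) hG
      have h3 := valuation_sum_aeval_le (Fq := Fq) O.valuation ha hC1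
        (fun i hi => (le_coeffNorm a O hi).trans (h1.trans hC1)) (x := x)
        (fun i => by
          have := (ValuationSubring.valuation_le_one_iff _ _).2 (hDx i)
          rw [map_mul] at this
          simpa using (le_inv_mul_iff₀ hvpos).2 this) hε'
      rw [← hf, ← hz, h2, hexp, pow_mul, pow_le_pow_iff_left₀ zero_le zero_le hQ0, ← hD, map_pow,
        ← inv_pow, pow_le_pow_iff_left₀ zero_le zero_le hqm] at h3
      have hvD : 0 < O.valuation D := zero_lt_iff.2 ((Valuation.ne_zero_iff _).2 hD0)
      calc O.valuation D * O.valuation z ≤ O.valuation D * (O.valuation D)⁻¹ := by gcongr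
        _ = 1 := mul_inv_cancel₀ hvD.ne'
    · have h2 := hM₂ O hO h1
      rw [← hk, ← pow_le_pow_iff_left₀ zero_le zero_le hqm]
      calc (O.valuation D ^ k) ^ Fintype.card Fq ^ (r * m)
          = O.valuation D₀ ^ k := by rw [← pow_mul, mul_comm, pow_mul, ← map_pow, hD]
        _ ≤ (coeffNorm r a O ^ M) ^ k :=
          pow_le_pow_left' (h2.trans (pow_le_pow_right₀ h1.le (by omega))) k
        _ = coeffNorm r a O ^ (k * M) := by rw [← pow_mul, mul_comm]
        _ ≤ _ := pow_le_pow_right₀ h1.le hm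

end SmallPoints

/-! ### Saturation of submodules -/

section Saturation

namespace Submodule

variable {R M : Type*} [CommRing R] [IsDomain R] [AddCommGroup M] [Module R M]

/-- The submodule of the elements that have a nonzero multiple in `N`. -/
def saturation (N : Submodule R M) : Submodule R M :=
  (torsion R (M ⧸ N)).comap N.mkQ

theorem mem_saturation {N : Submodule R M} {x : M} :
    x ∈ N.saturation ↔ ∃ g : R, g ≠ 0 ∧ g • x ∈ N := by
  rw [saturation, mem_comap, mem_torsion_iff]
  constructor
  · rintro ⟨g, hg⟩
    refine ⟨g, nonZeroDivisors.ne_zero g.2, ?_⟩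
    rwa [Submonoid.smul_def, ← map_smul, mkQ_apply, Quotient.mk_eq_zero] at hg
  · rintro ⟨g, hg0, hg⟩
    refine ⟨⟨g, mem_nonZeroDivisors_of_ne_zero hg0⟩, ?_⟩
    rwa [Submonoid.smul_def, ← map_smul, mkQ_apply, Quotient.mk_eq_zero]

theorem le_saturation (N : Submodule R M) : N ≤ N.saturation := fun x hx =>
  mem_saturation.2 ⟨1, one_ne_zero, by rwa [one_smul]⟩

end Submodule

open Polynomial

variable {Fq M : Type*} [Field Fq] [Finite Fq] [AddCommGroup M] [Module Fq[X] M]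

instance finite_degreeLT (m : ℕ) : Finite (degreeLT Fq m) :=
  Finite.of_equiv _ (degreeLTEquiv Fq m).symm.toEquiv

/-- If a finite set contains every element of an `𝔽_q[X]`-module that is, up to division, a
small linear combination of given elements, then saturations of finitely generated submodules are
finitely generated. -/
theorem fg_saturation_of_finite {W : Set M} (hW : W.Finite)
    (H : ∀ (n : ℕ) (x : Fin n → M), ∃ m : ℕ, ∀ (G : Fq[X]) (ε : Fin n → Fq[X]) (z : M), G ≠ 0 →
      (∀ i, (ε i).natDegree + m ≤ G.natDegree) → m ≤ G.natDegree →
      G • z = ∑ i, ε i • x i → z ∈ W)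
    {N : Submodule Fq[X] M} (hN : N.FG) : N.saturation.FG := by
  classical
  obtain ⟨n, x, rfl⟩ := Submodule.fg_iff_exists_fin_generating_family.1 hN
  obtain ⟨m, hm⟩ := H n x
  set N := Submodule.span Fq[X] (Set.range x)
  -- Formally `y = ∑ X⁻ᵐ (eᵢ + sᵢ / g) xᵢ` with a proper fraction `sᵢ / g`. For equal `e` the
  -- polynomial parts cancel in a difference, leaving numerators of degree at least `m` below that
  -- of `X ^ m * g * g'`.
  let P : M → (Fin n → degreeLT Fq m) → Prop := fun y e => y ∈ N.saturation ∧
    ∃ g : Fq[X], g ≠ 0 ∧ ∃ s : Fin n → Fq[X], (∀ i, (s i).degree < g.degree) ∧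
      (X ^ m * g) • y = ∑ i, (g * (e i : Fq[X]) + s i) • x i
  have hPW : ∀ y y' e, P y e → P y' e → y - y' ∈ W := by
    rintro y y' e ⟨-, g, hg, s, hs, hy⟩ ⟨-, g', hg', s', hs', hy'⟩
    have hG : X ^ m * g * g' ≠ 0 := mul_ne_zero (mul_ne_zero (pow_ne_zero _ X_ne_zero) hg) hg'
    have hdeg : (X ^ m * g * g').natDegree = m + g.natDegree + g'.natDegree := by
      rw [natDegree_mul (mul_ne_zero (pow_ne_zero _ X_ne_zero) hg) hg',
        natDegree_mul (pow_ne_zero _ X_ne_zero) hg, natDegree_X_pow]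
    refine hm _ (fun i => g' * s i - g * s' i) (y - y') hG (fun i => ?_) (by omega) ?_
    · have h1 := natDegree_sub_le (g' * s i) (g * s' i)
      have h2 := natDegree_mul_le (p := g') (q := s i)
      have h3 := natDegree_mul_le (p := g) (q := s' i)
      have h4 := natDegree_le_natDegree (hs i).le
      have h5 := natDegree_le_natDegree (hs' i).le
      rw [hdeg]
      omega
    · have h1 : (X ^ m * g * g') • (y - y') =
          g' • ((X ^ m * g) • y) - g • ((X ^ m * g') • y') := by
        rw [smul_sub, smul_smul, smul_smul]
        congr 2 <;> ring
      rw [h1, hy, hy', Finset.smul_sum, Finset.smul_sum, ← Finset.sum_sub_distrib]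
      refine Finset.sum_congr rfl fun i _ => ?_
      rw [smul_smul, smul_smul, ← sub_smul]
      congr 1
      ring
  have hdecomp : ∀ y ∈ N.saturation, ∃ e, ∃ u ∈ N, P (y - u) e := by
    intro y hy
    obtain ⟨g, hg, hgy⟩ := Submodule.mem_saturation.1 hy
    obtain ⟨c, hc⟩ := (Submodule.mem_span_range_iff_exists_fun _).1 hgy
    have hX : (X ^ m : Fq[X]).Monic := monic_X_pow m
    let e : Fin n → Fq[X] := fun i => (X ^ m * c i) / g
    -- The multiples of `X ^ m` in the quotients contribute an element of `N`; only the remainders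
    -- of degree below `m` stay, and over a finite field there are finitely many.
    let d : Fin n → Fq[X] := fun i => e i /ₘ X ^ m
    have he : ∀ i, e i %ₘ X ^ m ∈ degreeLT Fq m := fun i => by
      rw [mem_degreeLT]
      exact (degree_modByMonic_lt _ hX).trans_le (by rw [degree_X_pow])
    have hu : ∑ i, d i • x i ∈ N :=
      sum_mem fun i _ => N.smul_mem _ (Submodule.subset_span ⟨i, rfl⟩)
    refine ⟨fun i => ⟨e i %ₘ X ^ m, he i⟩, ∑ i, d i • x i, hu,
      sub_mem hy (N.le_saturation hu), g, hg, fun i => (X ^ m * c i) % g,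
      fun i => EuclideanDomain.mod_lt _ hg, ?_⟩
    have h1 : (X ^ m * g) • y = ∑ i, (X ^ m * c i) • x i := by
      rw [mul_smul, ← hc, Finset.smul_sum]
      exact Finset.sum_congr rfl fun i _ => smul_smul _ _ _
    rw [smul_sub, h1, Finset.smul_sum, ← Finset.sum_sub_distrib]
    refine Finset.sum_congr rfl fun i _ => ?_
    rw [smul_smul, ← sub_smul]
    congr 1
    have h2 : g * e i + (X ^ m * c i) % g = X ^ m * c i := EuclideanDomain.div_add_mod _ _
    have h3 : e i %ₘ X ^ m + X ^ m * d i = e i := modByMonic_add_div _ _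
    linear_combination (-1 : Fq[X]) * h2 - g * h3
  let rep : (Fin n → degreeLT Fq m) → M := fun e => if h : ∃ y, P y e then h.choose else 0
  have hrep : ∀ e y, P y e → P (rep e) e := fun e y hy => by
    have h : ∃ y, P y e := ⟨y, hy⟩
    simp only [rep, dif_pos h]
    exact h.choose_spec
  have hrepmem : ∀ e, rep e ∈ N.saturation := fun e => by
    by_cases h : ∃ y, P y e
    · exact (hrep e _ h.choose_spec).1
    · simp only [rep, dif_neg h]; exact zero_mem _
  have hfin : (Set.range x ∪ (Set.range rep ∪ (W ∩ N.saturation))).Finite :=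
    (Set.finite_range x).union ((Set.finite_range rep).union (hW.inter_of_left _))
  have heq : N.saturation =
      Submodule.span Fq[X] (Set.range x ∪ (Set.range rep ∪ (W ∩ N.saturation))) := by
    refine le_antisymm (fun y hy => ?_) (Submodule.span_le.2 ?_)
    · obtain ⟨e, u, hu, hP⟩ := hdecomp y hy
      have hP' := hrep e _ hP
      have h1 : y = u + (rep e + (y - u - rep e)) := by abel
      rw [h1]
      refine add_mem (Submodule.span_mono Set.subset_union_left hu)
        (add_mem (Submodule.subset_span (Or.inr (Or.inl ⟨e, rfl⟩)))
          (Submodule.subset_span (Or.inr (Or.inr ⟨hPW _ _ e hP hP', sub_mem hP.1 hP'.1⟩))))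
    · rintro y (hy | ⟨e, rfl⟩ | hy)
      · exact N.le_saturation (Submodule.subset_span hy)
      · exact hrepmem e
      · exact hy.2
  rw [heq]
  exact Submodule.fg_span hfin

/-- This is the hypothesis for the empty family: a point killed by `g` is also killed by `X ^ m *
g`, whose degree is large enough. -/
theorem finite_torsion_of_finite {W : Set M} (hW : W.Finite)
    (H : ∀ (n : ℕ) (x : Fin n → M), ∃ m : ℕ, ∀ (G : Fq[X]) (ε : Fin n → Fq[X]) (z : M), G ≠ 0 →
      (∀ i, (ε i).natDegree + m ≤ G.natDegree) → m ≤ G.natDegree →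
      G • z = ∑ i, ε i • x i → z ∈ W) :
    {z : M | ∃ g : Fq[X], g ≠ 0 ∧ g • z = 0}.Finite := by
  obtain ⟨m, hm⟩ := H 0 Fin.elim0
  refine hW.subset ?_
  rintro z ⟨g, hg, hz⟩
  refine hm (X ^ m * g) Fin.elim0 z (mul_ne_zero (pow_ne_zero _ X_ne_zero) hg)
    (fun i => i.elim0) ?_ (by simp [mul_smul, hz])
  rw [natDegree_mul (pow_ne_zero _ X_ne_zero) hg, natDegree_X_pow]
  omega

end Saturation

/-! ### Countable torsion-free modules over a Dedekind domain -/

section Splitting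

variable {R M P : Type*} [CommRing R] [AddCommGroup M] [Module R M] [AddCommGroup P] [Module R P]

/-- A module is the product of the kernel and the target of a map that has a section. -/
def LinearMap.equivKerProd (f : M →ₗ[R] P) (s : P →ₗ[R] M) (h : f ∘ₗ s = LinearMap.id) :
    M ≃ₗ[R] LinearMap.ker f × P where
  toFun m := (⟨m - s (f m), by
    have := LinearMap.congr_fun h (f m)
    simp only [LinearMap.comp_apply, LinearMap.id_apply] at this
    simp [this]⟩, f m)
  invFun x := x.1 + s x.2
  map_add' x y := by
    refine Prod.ext (Subtype.ext ?_) (map_add f x y)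
    simp only [map_add, Prod.fst_add, Submodule.coe_add]
    abel
  map_smul' c x := by
    refine Prod.ext (Subtype.ext ?_) (map_smul f c x)
    simp [smul_sub]
  left_inv m := by simp
  right_inv x := by
    have h1 := LinearMap.congr_fun h x.2
    simp only [LinearMap.comp_apply, LinearMap.id_apply] at h1
    have h2 : f x.1 = 0 := x.1.2
    exact Prod.ext (Subtype.ext (by simp [h1, h2])) (by simp [h1, h2])

theorem Submodule.exists_isCompl_of_projective (N : Submodule R M) [Module.Projective R (M ⧸ N)] :
    ∃ C : Submodule R M, IsCompl N C := by
  obtain ⟨s, hs⟩ := Module.projective_lifting_property N.mkQ LinearMap.id N.mkQ_surjective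
  have hs' : ∀ x, N.mkQ (s x) = x := fun x => LinearMap.congr_fun hs x
  refine ⟨LinearMap.range s, ?_, ?_⟩
  · rw [Submodule.disjoint_def]
    rintro _ hx ⟨y, rfl⟩
    rw [← Submodule.Quotient.mk_eq_zero, ← Submodule.mkQ_apply, hs'] at hx
    rw [hx, map_zero]
  · rw [codisjoint_iff, eq_top_iff]
    intro x _
    refine Submodule.mem_sup.2 ⟨x - s (N.mkQ x), ?_, s (N.mkQ x), ⟨_, rfl⟩, by abel⟩
    rw [← Submodule.Quotient.mk_eq_zero, ← Submodule.mkQ_apply, map_sub, hs', sub_self]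

/-- A finitely supported function to a product is a pair of finitely supported functions. -/
noncomputable def Finsupp.prodLEquiv (α : Type*) : (α →₀ M × P) ≃ₗ[R] (α →₀ M) × (α →₀ P) :=
  LinearEquiv.ofLinearMap
    ((Finsupp.mapRange.linearMap (LinearMap.fst R M P)).prod
      (Finsupp.mapRange.linearMap (LinearMap.snd R M P)))
    ((Finsupp.mapRange.linearMap (LinearMap.inl R M P)).coprod
      (Finsupp.mapRange.linearMap (LinearMap.inr R M P)))
    (by ext <;> simp) (by ext <;> simp)

/-- Eilenberg's swindle. -/
theorem nonempty_prod_finsupp_equiv [Countable M] [Module.Projective R M] :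
    Nonempty ((M × (ℕ →₀ R)) ≃ₗ[R] (ℕ →₀ R)) := by
  obtain ⟨e, he⟩ := exists_surjective_nat M
  have hsurj : Function.Surjective (Finsupp.linearCombination R e) := by
    rw [← LinearMap.range_eq_top, Finsupp.range_linearCombination, he.range_eq,
      Submodule.span_univ]
  obtain ⟨s, hs⟩ := Module.projective_lifting_property _ LinearMap.id hsurj
  let Y := LinearMap.ker (Finsupp.linearCombination R e)
  let e₀ : (ℕ →₀ R) ≃ₗ[R] M × Y :=
    (LinearMap.equivKerProd _ s hs).trans (LinearEquiv.prodComm R _ _)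
  -- Countably many copies of `R^(ℕ) ≅ M × Y` form `R^(ℕ)` again, and the factor `M^(ℕ)` absorbs one
  -- more `M`.
  let e₁ : (ℕ →₀ R) ≃ₗ[R] (ℕ →₀ M) × (ℕ →₀ Y) :=
    (Finsupp.domLCongr (Denumerable.eqv (ℕ × ℕ)).symm).trans
      ((Finsupp.curryLinearEquiv R).trans
        ((Finsupp.mapRange.linearEquiv e₀).trans (Finsupp.prodLEquiv (R := R) (M := M) (P := Y) ℕ)))
  let e₂ : (M × (ℕ →₀ M)) ≃ₗ[R] (ℕ →₀ M) :=
    ((LinearEquiv.prodCongr (Finsupp.uniqueLinearEquiv R M ()).symm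
      (LinearEquiv.refl R _)).trans (Finsupp.sumFinsuppLEquivProdFinsupp R).symm).trans
      (Finsupp.domLCongr ((Equiv.sumComm _ _).trans Equiv.natSumPUnitEquivNat))
  exact ⟨((LinearEquiv.prodCongr (LinearEquiv.refl R M) e₁).trans
    (LinearEquiv.prodAssoc R M (ℕ →₀ M) (ℕ →₀ Y)).symm).trans
    ((LinearEquiv.prodCongr e₂ (LinearEquiv.refl R _)).trans e₁.symm)⟩

end Splitting

section Dedekind

variable {A : Type*} [CommRing A] [IsDedekindDomain A]

theorem projective_of_isTorsionFree (P : Type*) [AddCommGroup P] [Module A P] [Module.Finite A P]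
    [Module.IsTorsionFree A P] : Module.Projective A P := by
  have := Module.finitePresentation_of_finite A P
  exact Module.Flat.projective_of_finitePresentation

/-- If all functionals had values in `m`, the splitting of a free cover would give `Q = m Q`. By
Nakayama some element of `1 + m` would kill `Q`, and it would be zero since `Q` is torsion-free and
nonzero. -/
theorem exists_not_range_le {Q : Type*} [AddCommGroup Q] [Module A Q] [Module.Finite A Q]
    [Module.IsTorsionFree A Q] [Nontrivial Q] {m : Ideal A} (hm : m ≠ ⊤) :
    ∃ g : Q →ₗ[A] A, ¬ LinearMap.range g ≤ m := by
  by_contra! hall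
  have := projective_of_isTorsionFree (A := A) Q
  obtain ⟨s, hs⟩ := Module.projective_def'.1 this
  have hle : (⊤ : Submodule A Q) ≤ m • ⊤ := by
    intro x _
    have hx := LinearMap.congr_fun hs x
    rw [LinearMap.comp_apply, LinearMap.id_apply, Finsupp.linearCombination_apply] at hx
    rw [← hx]
    exact sum_mem fun q _ => Submodule.smul_mem_smul
      (hall ((Finsupp.lapply q).comp s) ⟨x, rfl⟩) trivial
  obtain ⟨c, hc, hc0⟩ := Submodule.exists_sub_one_mem_and_smul_eq_zero_of_fg_of_le_smul m ⊤
    Module.Finite.fg_top hle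
  obtain ⟨x, hx⟩ := exists_ne (0 : Q)
  have hc1 : c = 0 := (smul_eq_zero_iff_left hx).1 (hc0 x trivial)
  rw [hc1, zero_sub] at hc
  exact hm ((Ideal.eq_top_iff_one m).2 (by simpa using m.neg_mem hc))

/-- Two nonzero projective modules have functionals whose images generate the unit ideal. -/
theorem exists_range_sup_range_eq_top (P Q : Type*) [AddCommGroup P] [Module A P]
    [Module.Finite A P] [Module.IsTorsionFree A P] [Nontrivial P] [AddCommGroup Q] [Module A Q]
    [Module.Finite A Q] [Module.IsTorsionFree A Q] [Nontrivial Q] :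
    ∃ (f : P →ₗ[A] A) (g : Q →ₗ[A] A), LinearMap.range f ⊔ LinearMap.range g = ⊤ := by
  classical
  have := projective_of_isTorsionFree (A := A) P
  obtain ⟨x, hx⟩ := exists_ne (0 : P)
  obtain ⟨f, hf⟩ := Module.Projective.exists_dual_ne_zero A hx
  set I : Ideal A := LinearMap.range f with hI
  have hI0 : I ≠ 0 := fun h0 => hf (by
    have : f x ∈ I := ⟨x, rfl⟩
    rwa [h0] at this)
  -- Only the finitely many primes containing the image of `f` need attention. The Chinese remainder
  -- theorem glues functionals good at each of them into one congruent to `g w` modulo every such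
  -- `w`.
  let s := (Ideal.finite_factors hI0).toFinset
  choose g hg using fun v : IsDedekindDomain.HeightOneSpectrum A =>
    exists_not_range_le (A := A) (Q := Q) v.isPrime.ne_top
  choose y hy using fun v : s => IsDedekindDomain.exists_forall_sub_mem_ideal (s := s)
    (fun v => v.asIdeal) (fun _ => 1) (fun v _ => v.prime)
    (fun v _ w _ hne h => hne (IsDedekindDomain.HeightOneSpectrum.ext h)) (Pi.single v 1)
  refine ⟨f, ∑ v : s, y v • g v, ?_⟩
  by_contra hne
  obtain ⟨m, hm, hle⟩ := Ideal.exists_le_maximal _ hne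
  have hIm : I ≤ m := le_sup_left.trans hle
  let w : IsDedekindDomain.HeightOneSpectrum A :=
    ⟨m, hm.isPrime, fun h0 => hI0 (by rw [h0] at hIm; exact le_bot_iff.1 hIm)⟩
  have hws : w ∈ s := (Ideal.finite_factors hI0).mem_toFinset.2 (Ideal.dvd_iff_le.2 hIm)
  refine hg w ?_
  rintro _ ⟨z, rfl⟩
  have h1 : (∑ v : s, y v • g v) z ∈ m := hle (le_sup_right (a := I) ⟨z, rfl⟩)
  have h2 : (∑ v : s, y v • g v) z - g w z ∈ m := by
    have h3 : g w z = ∑ v : s, (Pi.single v (1 : A) : s → A) ⟨w, hws⟩ * g v z := by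
      rw [Finset.sum_eq_single ⟨w, hws⟩]
      · rw [Pi.single_eq_same, one_mul]
      · intro v _ hv
        rw [Pi.single_eq_of_ne hv.symm, zero_mul]
      · intro h; exact absurd (Finset.mem_univ _) h
    rw [h3, LinearMap.sum_apply, ← Finset.sum_sub_distrib]
    refine sum_mem fun v _ => ?_
    rw [LinearMap.smul_apply, smul_eq_mul, ← sub_mul]
    refine Ideal.mul_mem_right _ _ ?_
    have := hy v w hws
    rwa [pow_one] at this
  have := m.sub_mem h1 h2
  rwa [sub_sub_cancel] at this

variable {M : Type*} [AddCommGroup M] [Module A M]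

theorem Submodule.saturation_saturation {R : Type*} [CommRing R] [IsDomain R] [Module R M]
    (N : Submodule R M) : N.saturation.saturation = N.saturation := by
  refine le_antisymm (fun x hx => ?_) (le_saturation _)
  obtain ⟨g, hg, hgx⟩ := mem_saturation.1 hx
  obtain ⟨g', hg', hgx'⟩ := mem_saturation.1 hgx
  exact mem_saturation.2 ⟨g' * g, mul_ne_zero hg' hg, by rwa [mul_smul]⟩

/-- Saturation of `N` makes `N' / N` torsion-free, hence projective, so the quotient map splits. -/
theorem Submodule.exists_compl_of_saturated {N N' : Submodule A M} (hN : N.saturation = N)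
    (hle : N ≤ N') (hN' : N'.FG) :
    ∃ C : Submodule A M, C ⊓ N = ⊥ ∧ C ⊔ N = N' ∧ C.FG := by
  have hfin : Module.Finite A N' := Module.Finite.iff_fg.2 hN'
  let N₀ : Submodule A N' := N.comap N'.subtype
  have htf : Module.IsTorsionFree A (N' ⧸ N₀) := by
    refine Module.IsTorsionFree.of_smul_eq_zero fun c x hcx => ?_
    obtain ⟨x, rfl⟩ := N₀.mkQ_surjective x
    rw [← map_smul, mkQ_apply, Quotient.mk_eq_zero] at hcx
    rw [mkQ_apply, Quotient.mk_eq_zero]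
    by_cases hc : c = 0
    · exact Or.inl hc
    · refine Or.inr ?_
      change (x : M) ∈ N
      rw [← hN]
      exact mem_saturation.2 ⟨c, hc, hcx⟩
  have := projective_of_isTorsionFree (A := A) (N' ⧸ N₀)
  obtain ⟨C, hC⟩ := N₀.exists_isCompl_of_projective
  have hmapN : N₀.map N'.subtype = N := by
    rw [map_comap_eq, range_subtype, inf_eq_right.2 hle]
  refine ⟨C.map N'.subtype, ?_, ?_, (IsNoetherian.noetherian C).map _⟩
  · rw [← hmapN, ← map_inf _ N'.injective_subtype, hC.symm.inf_eq_bot, map_bot]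
  · rw [← hmapN, ← map_sup, hC.symm.sup_eq_top, map_top, range_subtype]

/-- At step `k`, adjoin the `k`-th element of an enumeration and saturate. A further element outside
the current submodule, available because `M` is not finitely generated, makes every inclusion
strict. -/
theorem exists_strict_saturated_chain [Module.IsTorsionFree A M] [Countable M]
    (hsat : ∀ N : Submodule A M, N.FG → N.saturation.FG) (hM : ¬ Module.Finite A M) :
    ∃ N : ℕ → Submodule A M, N 0 = ⊥ ∧ (∀ k, N k < N (k + 1)) ∧ (∀ k, (N k).FG) ∧
      (∀ k, (N k).saturation = N k) ∧ ∀ x, ∃ k, x ∈ N k := by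
  obtain ⟨e, he⟩ := exists_surjective_nat M
  let S := {N : Submodule A M // N.FG ∧ N.saturation = N}
  have hstep : ∀ (N : S) (k : ℕ), ∃ N' : S, N.1 < N'.1 ∧ e k ∈ N'.1 := by
    rintro ⟨N, hN, hNs⟩ k
    have hne : N ≠ ⊤ := by
      rintro rfl
      exact hM ⟨hN⟩
    obtain ⟨y, -, hy⟩ := SetLike.exists_of_lt hne.lt_top
    have hfg : (N ⊔ Submodule.span A {e k, y}).FG :=
      hN.sup (Submodule.fg_span (Set.toFinite _))
    have hle := (N ⊔ Submodule.span A {e k, y}).le_saturation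
    refine ⟨⟨_, hsat _ hfg, Submodule.saturation_saturation _⟩,
      lt_of_le_of_ne (le_sup_left.trans hle) fun h => hy ?_, ?_⟩
    · rw [show N = _ from h]
      exact hle (Submodule.mem_sup_right (Submodule.subset_span (by simp)))
    · exact hle (Submodule.mem_sup_right (Submodule.subset_span (by simp)))
  choose next hlt hmem using hstep
  have hbot : (⊥ : Submodule A M).saturation = ⊥ := by
    refine le_antisymm (fun x hx => ?_) bot_le
    obtain ⟨g, hg, hgx⟩ := Submodule.mem_saturation.1 hx
    rw [Submodule.mem_bot] at hgx ⊢
    exact (smul_eq_zero_iff_right hg).1 hgx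
  let N : ℕ → S := fun k => Nat.rec ⟨⊥, Submodule.fg_bot, hbot⟩ (fun k N => next N k) k
  refine ⟨fun k => (N k).1, rfl, fun k => hlt (N k) k, fun k => (N k).2.1, fun k => (N k).2.2,
    fun x => ?_⟩
  obtain ⟨k, rfl⟩ := he x
  exact ⟨k + 1, hmem (N k) k⟩

/-- In a vanishing sum the component of largest index `J` lies in `C J ⊓ N J`; spanning is an
induction along the chain. -/
theorem isInternal_of_chain {R : Type*} [CommRing R] [Module R M] {N C : ℕ → Submodule R M}
    (h0 : N 0 = ⊥) (hinf : ∀ k, C k ⊓ N k = ⊥) (hsup : ∀ k, C k ⊔ N k = N (k + 1))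
    (hN : ∀ x, ∃ k, x ∈ N k) : DirectSum.IsInternal C := by
  classical
  have hmono : Monotone N := monotone_nat_of_le_succ fun k => (hsup k) ▸ le_sup_right
  have hCN : ∀ k, C k ≤ N (k + 1) := fun k => (hsup k) ▸ le_sup_left
  constructor
  · rw [injective_iff_map_eq_zero]
    intro x hx
    by_contra hne
    have hsne : (DFinsupp.support x).Nonempty := by
      rw [Finset.nonempty_iff_ne_empty, Ne, DFinsupp.support_eq_empty]
      exact hne
    set J := (DFinsupp.support x).max' hsne
    have hJ : J ∈ DFinsupp.support x := Finset.max'_mem _ _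
    have hx' : ∑ j ∈ DFinsupp.support x, (x j : M) = 0 := by
      rw [DirectSum.coeAddMonoidHom_eq_dfinsuppSum] at hx
      exact hx
    rw [← Finset.add_sum_erase _ _ hJ] at hx'
    have hrest : ∑ j ∈ (DFinsupp.support x).erase J, (x j : M) ∈ N J := by
      refine sum_mem fun j hj => ?_
      have hlt : j < J := lt_of_le_of_ne (Finset.le_max' _ _ (Finset.mem_of_mem_erase hj))
        (Finset.ne_of_mem_erase hj)
      exact hmono hlt (hCN j (x j).2)
    have hxJ : (x J : M) ∈ C J ⊓ N J :=
      ⟨(x J).2, by rw [eq_neg_of_add_eq_zero_left hx']; exact neg_mem hrest⟩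
    rw [hinf, Submodule.mem_bot] at hxJ
    exact (DFinsupp.mem_support_iff.1 hJ) (Subtype.ext hxJ)
  · intro x
    obtain ⟨k, hk⟩ := hN x
    have hall : ∀ k, N k ≤ LinearMap.range (DirectSum.coeLinearMap C) := by
      intro k
      induction k with
      | zero => rw [h0]; exact bot_le
      | succ k ih =>
        rw [← hsup]
        refine sup_le (fun y hy => ⟨DirectSum.of (fun i => C i) k ⟨y, hy⟩, ?_⟩) ih
        exact DirectSum.coeLinearMap_of C k ⟨y, hy⟩
    exact hall k hk

/-- A countable torsion-free module that is not finitely generated, over a Dedekind domain, is free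
if the saturations of its finitely generated submodules are finitely generated. -/
theorem nonempty_equiv_finsupp_nat [Module.IsTorsionFree A M] [Countable M]
    (hsat : ∀ N : Submodule A M, N.FG → N.saturation.FG) (hM : ¬ Module.Finite A M) :
    Nonempty (M ≃ₗ[A] (ℕ →₀ A)) := by
  classical
  obtain ⟨N, h0, hlt, hfg, hs, hN⟩ := exists_strict_saturated_chain hsat hM
  choose C hinf hsup hCfg using fun k =>
    Submodule.exists_compl_of_saturated (hs k) (hlt k).le (hfg (k + 1))
  have hCfin : ∀ k, Module.Finite A (C k) := fun k => Module.Finite.iff_fg.2 (hCfg k)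
  have hCnt : ∀ k, Nontrivial (C k) := fun k => by
    rw [Submodule.nontrivial_iff_ne_bot]
    intro hbot
    have := hsup k
    rw [hbot, bot_sup_eq] at this
    exact (hlt k).ne this
  have hCproj : ∀ k, Module.Projective A (C k) := fun k => projective_of_isTorsionFree _
  have hint := isInternal_of_chain h0 hinf hsup hN
  let Φ : (DirectSum ℕ fun k => C k) ≃ₗ[A] M :=
    LinearEquiv.ofBijective (DirectSum.coeLinearMap C) hint
  have hproj : Module.Projective A M := Module.Projective.of_equiv Φ
  choose f g hfg' using fun k => exists_range_sup_range_eq_top (A := A) (C (2 * k)) (C (2 * k + 1))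
  -- Storing both functionals of the pair `k` in one family over all `n`, zero elsewhere, lets `σ`
  -- use `h (n / 2) n` on `C n` without a cast between summands.
  have hh : ∀ k, ∃ h : ∀ n, C n →ₗ[A] A, LinearMap.range (h (2 * k)) ⊔
      LinearMap.range (h (2 * k + 1)) = ⊤ := fun k => by
    refine ⟨Function.update (Function.update 0 (2 * k) (f k)) (2 * k + 1) (g k), ?_⟩
    rw [Function.update_self, Function.update_of_ne (by omega), Function.update_self]
    exact hfg' k
  choose h hh using hh
  let σ : (DirectSum ℕ fun k => C k) →ₗ[A] (ℕ →₀ A) :=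
    DirectSum.toModule A ℕ _ fun n => (Finsupp.lsingle (n / 2)).comp (h (n / 2) n)
  have hσ : Function.Surjective σ := by
    rw [← LinearMap.range_eq_top, eq_top_iff]
    have hsingle : ∀ k, Finsupp.single k (1 : A) ∈ LinearMap.range σ := by
      intro k
      have h1 : (1 : A) ∈ LinearMap.range (h k (2 * k)) ⊔ LinearMap.range (h k (2 * k + 1)) := by
        rw [hh]; trivial
      obtain ⟨_, ⟨c, rfl⟩, _, ⟨c', rfl⟩, hc⟩ := Submodule.mem_sup.1 h1
      refine ⟨DirectSum.lof A ℕ (fun k => C k) (2 * k) c +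
        DirectSum.lof A ℕ (fun k => C k) (2 * k + 1) c', ?_⟩
      rw [map_add, DirectSum.toModule_lof, DirectSum.toModule_lof]
      have e1 : 2 * k / 2 = k := by omega
      have e2 : (2 * k + 1) / 2 = k := by omega
      simp only [LinearMap.comp_apply, Finsupp.lsingle_apply, e1, e2]
      rw [← Finsupp.single_add, hc]
    intro x _
    induction x using Finsupp.induction_linear with
    | zero => exact zero_mem _
    | add x y hx hy => exact add_mem (hx trivial) (hy trivial)
    | single k c =>
      rw [← mul_one c, ← smul_eq_mul, ← Finsupp.smul_single]
      exact Submodule.smul_mem _ _ (hsingle k)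
  -- The target is free, so `τ` splits; its kernel is countable and projective, and the swindle
  -- absorbs it.
  let τ : M →ₗ[A] (ℕ →₀ A) := σ.comp Φ.symm.toLinearMap
  have hτ : Function.Surjective τ := hσ.comp Φ.symm.surjective
  obtain ⟨s, hs'⟩ := Module.projective_lifting_property τ LinearMap.id hτ
  let e := LinearMap.equivKerProd τ s hs'
  have hker : Module.Projective A (LinearMap.ker τ) :=
    Module.Projective.of_split (e.symm.toLinearMap.comp (LinearMap.inl A _ _))
      ((LinearMap.fst A _ _).comp e.toLinearMap) (by ext x; simp)
  obtain ⟨e'⟩ := nonempty_prod_finsupp_equiv (R := A) (M := LinearMap.ker τ)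
  exact ⟨e.trans e'⟩

/-- The structure of a countable module over a Dedekind domain that is not finitely generated,
has finite torsion, and in which the saturations of finitely generated submodules are finitely
generated. -/
theorem exists_isCompl_torsion_free [Countable M]
    (hsat : ∀ N : Submodule A M, N.FG → N.saturation.FG) (hM : ¬ Module.Finite A M)
    (htors : Finite (Submodule.torsion A M)) :
    ∃ T N : Submodule A M, IsCompl T N ∧ Finite T ∧ Module.IsTorsion A T ∧ Module.Free A N ∧
      Module.rank A N = Cardinal.aleph0 := by
  set T := Submodule.torsion A M with hT
  have hMT : ¬ Module.Finite A (M ⧸ T) := fun h =>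
    hM (Module.Finite.of_submodule_quotient T)
  -- The saturation of the span of lifts maps onto the saturation downstairs: a relation modulo
  -- torsion becomes exact after one more nonzero factor.
  have hsat' : ∀ N : Submodule A (M ⧸ T), N.FG → N.saturation.FG := by
    intro N hN
    obtain ⟨n, x, rfl⟩ := Submodule.fg_iff_exists_fin_generating_family.1 hN
    choose y hy using fun i => T.mkQ_surjective (x i)
    have hfg : ((Submodule.span A (Set.range y)).saturation.map T.mkQ).FG :=
      (hsat _ (Submodule.fg_span (Set.finite_range y))).map _
    refine hfg.of_le ?_
    intro z hz
    obtain ⟨z, rfl⟩ := T.mkQ_surjective z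
    obtain ⟨c, hc, hcz⟩ := Submodule.mem_saturation.1 hz
    have hmap : Submodule.span A (Set.range x) = (Submodule.span A (Set.range y)).map T.mkQ := by
      rw [Submodule.map_span, ← Set.range_comp]
      congr 2
      exact funext fun i => (hy i).symm
    rw [hmap] at hcz
    obtain ⟨w, hw, hwz⟩ := hcz
    rw [← map_smul, ← sub_eq_zero, ← map_sub, Submodule.mkQ_apply, Submodule.Quotient.mk_eq_zero,
      hT, Submodule.mem_torsion_iff] at hwz
    obtain ⟨d, hd⟩ := hwz
    refine ⟨z, Submodule.mem_saturation.2 ⟨d * c, mul_ne_zero (nonZeroDivisors.ne_zero d.2) hc, ?_⟩,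
      rfl⟩
    rw [Submonoid.smul_def, smul_sub, sub_eq_zero] at hd
    rw [mul_smul, ← hd]
    exact Submodule.smul_mem _ _ hw
  have : Countable (M ⧸ T) := T.mkQ_surjective.countable
  obtain ⟨e⟩ := nonempty_equiv_finsupp_nat hsat' hMT
  have hfree : Module.Free A (M ⧸ T) := Module.Free.of_equiv e.symm
  obtain ⟨N, hN⟩ := T.exists_isCompl_of_projective
  let e' : N ≃ₗ[A] (ℕ →₀ A) := (Submodule.quotientEquivOfIsCompl T N hN).symm.trans e
  refine ⟨T, N, hN, htors, Submodule.torsion_isTorsion, Module.Free.of_equiv e'.symm, ?_⟩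
  have := e'.lift_rank_eq
  rw [rank_finsupp_self] at this
  simpa using this

end Dedekind

/-! ### Transfer of saturation properties along an integral extension -/

section Transfer

variable (R : Type*) {A M : Type*} [CommRing R] [IsDomain R] [IsNoetherianRing R] [CommRing A]
  [IsDomain A] [Algebra R A] [AddCommGroup M] [Module R M] [Module A M] [IsScalarTower R A M]

/-- A domain of finite rank over `R` that acts faithfully on an element of a module in which
saturations are finitely generated is finite over `R`. -/
theorem Module.finite_of_fg_saturation
    (hsat : ∀ N : Submodule R M, N.FG → N.saturation.FG) (s : Finset A)
    (hs : ∀ a : A, ∃ g : R, g ≠ 0 ∧ g • a ∈ Submodule.span R (s : Set A)) {x : M}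
    (hx : ∀ a : A, a • x = 0 → a = 0) : Module.Finite R A := by
  -- The orbit map embeds `A` in the saturation of a finitely generated submodule, a Noetherian
  -- module. No separability of the extension is needed.
  let f : A →ₗ[R] M := (LinearMap.toSpanSingleton A M x).restrictScalars R
  have hf : Function.Injective f := (injective_iff_map_eq_zero f).2 hx
  let N := (Submodule.span R (s : Set A)).map f
  have hN : N.FG := Submodule.FG.map f ⟨s, rfl⟩
  have hmem : ∀ a, f a ∈ N.saturation := fun a => by
    obtain ⟨g, hg, hga⟩ := hs a
    exact Submodule.mem_saturation.2 ⟨g, hg, g • a, hga, map_smul f g a⟩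
  have : Module.Finite R N.saturation := Module.Finite.iff_fg.2 (hsat N hN)
  have : IsNoetherian R N.saturation := isNoetherian_of_isNoetherianRing_of_finite R _
  exact Module.Finite.of_injective (f.codRestrict N.saturation hmem)
    fun a b h => hf (congrArg Subtype.val h)

/-- A nonzero element algebraic over `R` divides a nonzero element of `R`, so torsion and saturation
over `A` are controlled by those over `R`. -/
theorem exists_ne_zero_smul_mem [Algebra.IsAlgebraic R A] {N : Submodule A M} {x : M} {a : A}
    (ha : a ≠ 0) (hx : a • x ∈ N) : ∃ g : R, g ≠ 0 ∧ g • x ∈ N := by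
  obtain ⟨c, d, hd, h⟩ := Algebra.IsAlgebraic.exists_smul_eq_mul R (1 : A) ha
  refine ⟨d, hd, ?_⟩
  rw [← one_smul A x, ← smul_assoc, h, mul_comm, mul_smul]
  exact N.smul_mem c hx

theorem fg_saturation_of_algebra [Module.Finite R A]
    (hsat : ∀ N : Submodule R M, N.FG → N.saturation.FG) {N : Submodule A M} (hN : N.FG) :
    N.saturation.FG := by
  have : Algebra.IsAlgebraic R A := Algebra.IsIntegral.isAlgebraic
  have : Module.Finite A N := Module.Finite.iff_fg.2 hN
  have hN' : (N.restrictScalars R).FG :=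
    Module.Finite.iff_fg.1 (Module.Finite.trans (R := R) A N)
  have h1 : (N.saturation.restrictScalars R).FG := by
    refine Submodule.FG.of_le (hsat _ hN') fun x hx => ?_
    obtain ⟨a, ha, hax⟩ := Submodule.mem_saturation.1 hx
    exact Submodule.mem_saturation.2 (exists_ne_zero_smul_mem R (N := N) ha hax)
  exact Submodule.FG.of_restrictScalars R h1

/-- The structure of a countable module over an integrally closed integral extension of finite
rank of a ring `R` of dimension one, given the finiteness of its saturations over `R`. -/
theorem exists_isCompl_torsion_free_of_isIntegral [Ring.DimensionLEOne R] [Algebra.IsIntegral R A]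
    [IsIntegrallyClosed A] [Countable M]
    (s : Finset A) (hs : ∀ a : A, ∃ g : R, g ≠ 0 ∧ g • a ∈ Submodule.span R (s : Set A))
    (hsat : ∀ N : Submodule R M, N.FG → N.saturation.FG)
    (htors : {x : M | ∃ g : R, g ≠ 0 ∧ g • x = 0}.Finite) (hM : ¬ Module.Finite A M) :
    ∃ T N : Submodule A M, IsCompl T N ∧ Finite T ∧ Module.IsTorsion A T ∧ Module.Free A N ∧
      Module.rank A N = Cardinal.aleph0 := by
  have : Algebra.IsAlgebraic R A := Algebra.IsIntegral.isAlgebraic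
  have htors' : ∀ (a : A) (x : M), a ≠ 0 → a • x = 0 → ∃ g : R, g ≠ 0 ∧ g • x = 0 :=
    fun a x ha hx => exists_ne_zero_smul_mem R (N := (⊥ : Submodule A M)) ha hx
  have hinf : Infinite M := by
    by_contra h
    rw [not_infinite_iff_finite] at h
    exact hM inferInstance
  -- A nontorsion point exists: `M` is infinite, as a finite module is finitely generated, while the
  -- torsion is finite.
  obtain ⟨x, hx⟩ := htors.exists_notMem
  have : Module.Finite R A := Module.finite_of_fg_saturation R hsat s hs (x := x) fun a ha => by
    by_contra h0
    exact hx (htors' a x h0 ha)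
  have : IsNoetherianRing A := IsNoetherianRing.of_finite R A
  have : Ring.DimensionLEOne A := Ring.DimensionLEOne.of_isIntegral R A
  have : IsDedekindRing A := { }
  have : IsDedekindDomain A := { }
  refine exists_isCompl_torsion_free (fun N hN => fg_saturation_of_algebra R hsat hN) hM ?_
  refine (htors.subset fun y hy => ?_).to_subtype
  obtain ⟨a, ha⟩ := (Submodule.mem_torsion_iff y).1 hy
  exact htors' a y (nonZeroDivisors.ne_zero a.2) ha

end Transfer

/-! ### The ring of functions regular away from a point -/

section RegularAway

open Polynomial

variable {k F : Type*} [Field k] [Field F] [Algebra k F]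

/-- A function with no pole at all is integral over `k`, hence algebraic, so the pole of `t` must be
at `P`. -/
theorem CurvePoint.notMem_of_transcendental {P : CurvePoint k F} {t : F} (ht : t ∈ regularAway P)
    (htr : Transcendental k t) : t ∉ P.1 := fun hP => htr <| by
  refine (isIntegral_of_forall_mem_valuationSubring fun O hO => ?_).isAlgebraic
  by_cases htop : O = ⊤
  · rw [htop]; trivial
  · by_cases hOP : (⟨O, htop, hO⟩ : CurvePoint k F) = P
    · rw [← hOP] at hP; exact hP
    · exact ht ⟨O, htop, hO⟩ hOP

theorem algebraMap_polynomial_eq_aeval [Algebra k[X] F] [IsScalarTower k k[X] F] (g : k[X]) :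
    algebraMap k[X] F g = aeval (algebraMap k[X] F X) g := by
  rw [aeval_algebraMap_apply, aeval_X_left_apply]

theorem algebraMap_injective_of_transcendental [Algebra k[X] F] [IsScalarTower k k[X] F]
    (htr : Transcendental k (algebraMap k[X] F X)) :
    Function.Injective (algebraMap k[X] F) := fun a b hab =>
  transcendental_iff_injective.1 htr (by
    rw [← algebraMap_polynomial_eq_aeval, ← algebraMap_polynomial_eq_aeval, hab])

/-- Since the only pole of `t` is at `P`, the points whose local rings contain `k[t]` are those
other than `P`, and the integral closure is the intersection of these rings. -/
theorem mem_regularAway_iff_isIntegral [Algebra k[X] F] [IsScalarTower k k[X] F]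
    {P : CurvePoint k F} (ht : algebraMap k[X] F X ∈ regularAway P)
    (htr : Transcendental k (algebraMap k[X] F X)) {f : F} :
    f ∈ regularAway P ↔ IsIntegral k[X] f := by
  constructor
  · refine fun hf => isIntegral_of_forall_mem_valuationSubring fun O hO => ?_
    by_cases htop : O = ⊤
    · rw [htop]; trivial
    · have hOk : ∀ c : k, algebraMap k F c ∈ O := fun c => by
        rw [IsScalarTower.algebraMap_apply k k[X] F]; exact hO _
      refine hf ⟨O, htop, hOk⟩ fun h => ?_
      exact CurvePoint.notMem_of_transcendental ht htr (by rw [← h]; exact hO X)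
  · intro hf Q hQ
    refine ValuationSubring.mem_of_isIntegral (fun g => ?_) hf
    rw [algebraMap_polynomial_eq_aeval]
    exact ValuationSubring.aeval_mem Q.2.2 (ht Q hQ) g

theorem IsCurveFunctionField.isAlgebraic_of_transcendental (hF : IsCurveFunctionField k F)
    [Algebra k[X] F] [IsScalarTower k k[X] F] (htr : Transcendental k (algebraMap k[X] F X)) :
    Algebra.IsAlgebraic k[X] F := by
  have h := isAlgebraic_adjoin_singleton_of_trdeg_le_one hF.trdeg_eq_one.le htr
  refine ⟨fun x => ?_⟩
  let σ : k[X] →+* Algebra.adjoin k {algebraMap k[X] F X} :=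
    (algebraMap k[X] F).codRestrict _ fun g => by
      rw [algebraMap_polynomial_eq_aeval g]
      exact aeval_mem_adjoin_singleton k (algebraMap k[X] F X)
  have hσ : Function.Surjective σ := by
    rintro ⟨y, hy⟩
    have hy' := hy
    rw [Algebra.adjoin_singleton_eq_range_aeval] at hy'
    obtain ⟨g, rfl⟩ := hy'
    exact ⟨g, Subtype.ext (algebraMap_polynomial_eq_aeval g)⟩
  obtain ⟨p, hp0, hp⟩ := h.isAlgebraic x
  obtain ⟨p', rfl⟩ := Polynomial.map_surjective σ hσ p
  refine ⟨p', fun h0 => hp0 (by rw [h0, Polynomial.map_zero]), ?_⟩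
  rw [aeval_def, eval₂_map] at hp
  exact hp

/-- The field `F` is finite over `k(t)` and has a basis integral over `k[t]`; the multiplier `g`
clears the denominators of the coordinates. -/
theorem exists_finset_span [Algebra k[X] F] [IsScalarTower k k[X] F]
    (hF : IsCurveFunctionField k F) (htr : Transcendental k (algebraMap k[X] F X)) :
    ∃ s : Finset F, (∀ x ∈ s, IsIntegral k[X] x) ∧
      ∀ x : F, ∃ g : k[X], g ≠ 0 ∧ g • x ∈ Submodule.span k[X] (s : Set F) := by
  classical
  have := hF.isAlgebraic_of_transcendental htr
  have hinj : Function.Injective (algebraMap k[X] F) :=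
    algebraMap_injective_of_transcendental htr
  have : FaithfulSMul k[X] F := (faithfulSMul_iff_algebraMap_injective _ _).2 hinj
  let K := FractionRing k[X]
  let _ : Algebra K F := FractionRing.liftAlgebra k[X] F
  have : IsScalarTower k[X] K F := FractionRing.isScalarTower_liftAlgebra k[X] F
  have : IsScalarTower k K F := IsScalarTower.of_algebraMap_eq fun c => by
    rw [IsScalarTower.algebraMap_apply k k[X] F, IsScalarTower.algebraMap_apply k k[X] K,
      ← IsScalarTower.algebraMap_apply k[X] K F]
  have : Algebra.EssFiniteType k F := IntermediateField.fg_top_iff.1 hF.fg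
  have : Algebra.EssFiniteType K F := Algebra.EssFiniteType.of_comp k K F
  have : Algebra.IsAlgebraic K F := (IsFractionRing.comap_isAlgebraic_iff (A := k[X])).1 ‹_›
  have : FiniteDimensional K F := Algebra.finite_of_essFiniteType_of_isAlgebraic
  obtain ⟨s, b, hb⟩ := FiniteDimensional.exists_is_basis_integral k[X] K F
  refine ⟨Finset.univ.image b, ?_, fun x => ?_⟩
  · simp only [Finset.mem_image, Finset.mem_univ, true_and, forall_exists_index]
    rintro _ i rfl
    exact hb i
  · obtain ⟨g, hg⟩ := IsLocalization.exist_integer_multiples_of_finset (nonZeroDivisors k[X])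
      (Finset.univ.image (b.repr x))
    refine ⟨g, nonZeroDivisors.ne_zero g.2, ?_⟩
    rw [← b.sum_repr x, Finset.smul_sum]
    refine sum_mem fun i _ => ?_
    obtain ⟨c, hc⟩ := hg (b.repr x i) (Finset.mem_image_of_mem _ (Finset.mem_univ i))
    rw [← smul_assoc]
    rw [show (g : k[X]) • b.repr x i = algebraMap k[X] K c from hc.symm, algebraMap_smul]
    exact Submodule.smul_mem _ _ (Submodule.subset_span (by simp))

/-- The structure of a countable module over the ring of functions regular away from a point, given
the finiteness of its saturations over the polynomial ring in a nonconstant function. -/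
theorem exists_isCompl_torsion_free_regularAway (hF : IsCurveFunctionField k F)
    {P : CurvePoint k F} {t : regularAway P} (htr : Transcendental k t) {M : Type*}
    [AddCommGroup M] [Countable M] [Module k[X] M] [Module (regularAway P) M]
    (hsmul : ∀ (g : k[X]) (x : M), g • x = aeval t g • x)
    (hsat : ∀ N : Submodule k[X] M, N.FG → N.saturation.FG)
    (htors : {x : M | ∃ g : k[X], g ≠ 0 ∧ g • x = 0}.Finite)
    (hM : ¬ Module.Finite (regularAway P) M) :
    ∃ T N : Submodule (regularAway P) M, IsCompl T N ∧ Finite T ∧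
      Module.IsTorsion (regularAway P) T ∧ Module.Free (regularAway P) N ∧
      Module.rank (regularAway P) N = Cardinal.aleph0 := by
  classical
  let _ : Algebra k[X] (regularAway P) := (aeval t).toAlgebra
  let _ : Algebra k[X] F := ((algebraMap (regularAway P) F).comp (aeval t : k[X] →ₐ[k] _)).toAlgebra
  have : IsScalarTower k[X] (regularAway P) F := IsScalarTower.of_algebraMap_eq fun _ => rfl
  have : IsScalarTower k k[X] F := IsScalarTower.of_algebraMap_eq fun c => by
    change _ = algebraMap (regularAway P) F (aeval t (algebraMap k k[X] c))
    rw [AlgHom.commutes]; rfl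
  have hX : algebraMap k[X] F X = t := by
    change algebraMap (regularAway P) F (aeval t X) = t
    rw [aeval_X]; rfl
  have htr' : Transcendental k (algebraMap k[X] F X) := by
    rw [hX]
    exact (transcendental_algebraMap_iff (R := k) (A := F) (S := regularAway P)
      Subtype.val_injective).2 htr
  have hmem : ∀ {f : F}, f ∈ regularAway P ↔ IsIntegral k[X] f :=
    mem_regularAway_iff_isIntegral (by rw [hX]; exact t.2) htr'
  have : IsIntegralClosure (regularAway P) k[X] F :=
    ⟨Subtype.val_injective, fun {x} => ⟨fun hx => ⟨⟨x, hmem.2 hx⟩, rfl⟩, by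
      rintro ⟨y, rfl⟩; exact hmem.1 y.2⟩⟩
  have : Algebra.IsIntegral k[X] (regularAway P) := IsIntegralClosure.isIntegral_algebra k[X] F
  have : Algebra.IsAlgebraic k[X] F := hF.isAlgebraic_of_transcendental htr'
  have hinj : Function.Injective (algebraMap k[X] F) :=
    algebraMap_injective_of_transcendental htr'
  have : IsFractionRing (regularAway P) F :=
    IsIntegralClosure.isFractionRing_of_algebraic k[X] (regularAway P)
      ((injective_iff_map_eq_zero _).1 hinj)
  have : IsIntegrallyClosed (regularAway P) := by
    refine (isIntegrallyClosed_iff F).2 fun {x} hx => ?_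
    have : IsIntegral k[X] x := isIntegral_trans x hx
    exact ⟨⟨x, hmem.2 this⟩, rfl⟩
  have : IsScalarTower k[X] (regularAway P) M := ⟨fun g a x => by
    rw [hsmul, ← mul_smul]; rfl⟩
  obtain ⟨s, hs, hspan⟩ := exists_finset_span hF htr'
  let ι : regularAway P →ₗ[k[X]] F := (IsScalarTower.toAlgHom k[X] (regularAway P) F).toLinearMap
  have hι : Function.Injective ι := Subtype.val_injective
  refine exists_isCompl_torsion_free_of_isIntegral k[X]
    (s.preimage ι hι.injOn) (fun a => ?_) hsat htors hM
  obtain ⟨g, hg, hga⟩ := hspan a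
  refine ⟨g, hg, ?_⟩
  have h1 : ι (g • a) ∈
      (Submodule.span k[X] (s.preimage ι hι.injOn : Set (regularAway P))).map ι := by
    rw [Submodule.map_span, Finset.coe_preimage, Set.image_preimage_eq_of_subset]
    · rw [map_smul]; exact hga
    · exact fun x hx => ⟨⟨x, hmem.2 (hs x hx)⟩, rfl⟩
  obtain ⟨b, hb, hba⟩ := h1
  exact hι hba ▸ hb

end RegularAway

/-! ### Degrees of twisted polynomials -/

namespace TwistedPoly

variable {Fq : Type*} [Field Fq] [Fintype Fq] {K : Type*} [Field K] [Algebra Fq K]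

theorem mem_support {f : TwistedPoly Fq K} {n : ℕ} : n ∈ f.support ↔ f.coeff n ≠ 0 :=
  SkewPolynomial.mem_support_iff

theorem sum_support_monomial (f : TwistedPoly Fq K) :
    ∑ n ∈ f.support, monomial n (f.coeff n) = f := ext_coeff fun n => by
  simp only [coeff_sum, coeff_monomial, Finset.sum_ite_eq']
  split_ifs with h
  · rfl
  · exact (not_not.1 (mt mem_support.2 h)).symm

theorem coeff_mul (f g : TwistedPoly Fq K) (n : ℕ) :
    (f * g).coeff n = ∑ x ∈ Finset.HasAntidiagonal.antidiagonal n,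
      f.coeff x.1 * g.coeff x.2 ^ Fintype.card Fq ^ x.1 := by
  conv_lhs => rw [← sum_support_monomial f, ← sum_support_monomial g]
  simp only [Finset.sum_mul_sum, monomial_mul_monomial, coeff_sum, coeff_monomial]
  rw [← Finset.sum_product', ← Finset.sum_filter]
  refine Finset.sum_subset (fun x hx => ?_) fun x hx hx' => ?_
  · exact Finset.HasAntidiagonal.mem_antidiagonal.2 (Finset.mem_filter.1 hx).2
  · simp only [Finset.mem_filter, Finset.mem_product, mem_support,
      Finset.HasAntidiagonal.mem_antidiagonal.1 hx,
      and_true, not_and_or, not_not] at hx'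
    rcases hx' with h | h
    · rw [h, zero_mul]
    · rw [h, zero_pow (pow_ne_zero _ Fintype.card_ne_zero), mul_zero]

theorem toEnd_eq_sum_range (L : Type*) [Field L] [Algebra K L] {f : TwistedPoly Fq K} {r : ℕ}
    (hf : ∀ n, r < n → f.coeff n = 0) (x : L) :
    toEnd L f x =
      ∑ n ∈ Finset.range (r + 1), algebraMap K L (f.coeff n) * x ^ Fintype.card Fq ^ n := by
  rw [toEnd_apply]
  refine Finset.sum_subset (fun n hn => ?_) fun n _ hn => ?_
  · by_contra h
    exact mem_support.1 hn (hf n (by simpa using h))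
  · rw [not_not.1 (mt mem_support.2 hn), map_zero, zero_mul]

/-- The twisted polynomial `f` has degree `d`. -/
def HasDegree (f : TwistedPoly Fq K) (d : ℕ) : Prop :=
  f.coeff d ≠ 0 ∧ ∀ n, d < n → f.coeff n = 0

theorem exists_hasDegree {f : TwistedPoly Fq K} {n : ℕ} (hn : f.coeff n ≠ 0) :
    ∃ d, n ≤ d ∧ f.HasDegree d := by
  have hne : f.support.Nonempty := ⟨n, mem_support.2 hn⟩
  refine ⟨f.support.max' hne, Finset.le_max' _ _ (mem_support.2 hn),
    mem_support.1 (Finset.max'_mem _ _), fun m hm => ?_⟩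
  by_contra h
  exact (Finset.le_max' _ _ (mem_support.2 h)).not_gt hm

theorem HasDegree.mul {f g : TwistedPoly Fq K} {d e : ℕ} (hf : f.HasDegree d)
    (hg : g.HasDegree e) : (f * g).HasDegree (d + e) := by
  have h0 : (0 : K) ^ Fintype.card Fq ^ d = 0 := zero_pow (pow_ne_zero _ Fintype.card_ne_zero)
  constructor
  · rw [coeff_mul, Finset.sum_eq_single (d, e)]
    · exact mul_ne_zero hf.1 (pow_ne_zero _ hg.1)
    · rintro ⟨i, j⟩ hij hne
      rw [Finset.HasAntidiagonal.mem_antidiagonal] at hij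
      rcases lt_trichotomy i d with h | h | h
      · rw [hg.2 j (by simp only at hij; omega),
          zero_pow (pow_ne_zero _ Fintype.card_ne_zero), mul_zero]
      · exact absurd (Prod.ext h (by simp only at hij ⊢; omega)) hne
      · rw [hf.2 i h, zero_mul]
    · exact fun h => absurd
        (Finset.HasAntidiagonal.mem_antidiagonal.2 (show d + e = d + e from rfl)) h
  · intro n hn
    rw [coeff_mul]
    refine Finset.sum_eq_zero ?_
    rintro ⟨i, j⟩ hij
    rw [Finset.HasAntidiagonal.mem_antidiagonal] at hij
    rcases le_or_gt i d with h | h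
    · rw [hg.2 j (by simp only at hij; omega),
        zero_pow (pow_ne_zero _ Fintype.card_ne_zero), mul_zero]
    · rw [hf.2 i h, zero_mul]

theorem hasDegree_one : (1 : TwistedPoly Fq K).HasDegree 0 := by
  rw [← map_one (C : K →+* TwistedPoly Fq K)]
  exact ⟨by rw [coeff_C, if_pos rfl]; exact one_ne_zero,
    fun n hn => by rw [coeff_C, if_neg hn.ne']⟩

theorem HasDegree.pow {f : TwistedPoly Fq K} {d : ℕ} (hf : f.HasDegree d) (m : ℕ) :
    (f ^ m).HasDegree (m * d) := by
  induction m with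
  | zero => simpa using hasDegree_one
  | succ m ih => rw [pow_succ, Nat.succ_mul]; exact ih.mul hf

theorem HasDegree.eq {f : TwistedPoly Fq K} {d e : ℕ} (hd : f.HasDegree d)
    (he : f.HasDegree e) : d = e := by
  by_contra h
  rcases lt_or_gt_of_ne h with h | h
  · exact he.1 (hd.2 _ h)
  · exact hd.1 (he.2 _ h)

/-- A twisted polynomial that commutes with a monic twisted polynomial of positive degree with
coefficients in a valuation ring has its coefficients in this valuation ring. -/
theorem coeff_mem_of_commute {O : ValuationSubring K} {f g : TwistedPoly Fq K} {r : ℕ}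
    (hr : r ≠ 0) (hlead : f.coeff r = 1) (hdeg : ∀ n, r < n → f.coeff n = 0)
    (hf : ∀ n, f.coeff n ∈ O) (hcomm : f * g = g * f) (n : ℕ) : g.coeff n ∈ O := by
  by_contra hn
  have hn0 : g.coeff n ≠ 0 := fun h => hn (h ▸ O.zero_mem)
  obtain ⟨j, hj, hmax⟩ := Finset.exists_max_image g.support (fun n => O.valuation (g.coeff n))
    ⟨n, mem_support.2 hn0⟩
  have hq : 1 < Fintype.card Fq := Fintype.one_lt_card
  -- Compare the coefficients of `τ ^ (r + j)`, where `V > 1` is the largest value of a coefficient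
  -- of `g`. In `f * g` it has value exactly `V ^ (q ^ r)`; in `g * f` the Frobenius powers fall on
  -- the integral coefficients of `f`, so the value is at most `V`.
  set V := O.valuation (g.coeff j) with hV
  have hV1 : 1 < V := by
    refine lt_of_lt_of_le (not_le.1 fun h => hn ((O.valuation_le_one_iff _).1 h))
      (hmax n (mem_support.2 hn0))
  have hle : ∀ m, O.valuation (g.coeff m) ≤ V := fun m => by
    by_cases hm : g.coeff m = 0
    · rw [hm, map_zero]; exact zero_le
    · exact hmax m (mem_support.2 hm)
  have hf1 : ∀ m, O.valuation (f.coeff m) ≤ 1 := fun m => (O.valuation_le_one_iff _).2 (hf m)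
  have hlt : ∀ i, i < r → V ^ Fintype.card Fq ^ i < V ^ Fintype.card Fq ^ r := fun i hi =>
    pow_lt_pow_right₀ hV1 (Nat.pow_lt_pow_right hq hi)
  have h1 : O.valuation ((g * f).coeff (r + j)) ≤ V := by
    rw [coeff_mul]
    refine Valuation.map_sum_le _ fun x _ => ?_
    rw [map_mul, map_pow]
    calc _ ≤ V * 1 := mul_le_mul' (hle _) (pow_le_one' (hf1 _) _)
      _ = V := mul_one _
  have h2 : O.valuation ((f * g).coeff (r + j)) = V ^ Fintype.card Fq ^ r := by
    have hmem : (r, j) ∈ Finset.HasAntidiagonal.antidiagonal (r + j) :=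
      Finset.HasAntidiagonal.mem_antidiagonal.2 rfl
    rw [coeff_mul, ← Finset.add_sum_erase _ _ hmem]
    have hr1 : O.valuation (f.coeff r * g.coeff j ^ Fintype.card Fq ^ r) =
        V ^ Fintype.card Fq ^ r := by rw [hlead, one_mul, map_pow]
    rw [Valuation.map_add_eq_of_lt_left, hr1]
    rw [hr1]
    refine Valuation.map_sum_lt _ (pow_ne_zero _ (zero_lt_one.trans hV1).ne') ?_
    rintro ⟨i, k⟩ hik
    rw [Finset.mem_erase, Finset.HasAntidiagonal.mem_antidiagonal] at hik
    rcases lt_trichotomy i r with h | h | h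
    · rw [map_mul, map_pow]
      calc _ ≤ 1 * V ^ Fintype.card Fq ^ i :=
            mul_le_mul' (hf1 _) (pow_le_pow_left' (hle _) _)
        _ < _ := by rw [one_mul]; exact hlt i h
    · exact absurd (Prod.ext h (by have := hik.2; simp only at this ⊢; omega)) hik.1
    · rw [hdeg i h, zero_mul, map_zero]
      exact pow_pos (zero_lt_one.trans hV1) _
  rw [hcomm] at h2
  have h3 := hlt 0 (Nat.pos_of_ne_zero hr)
  rw [pow_zero, pow_one, ← h2] at h3
  exact h3.not_ge h1

end TwistedPoly

/-! ### Small points over a field of characteristic `p` -/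

section CharP

open Polynomial

/-- Extend `x` to a transcendence basis and adjoin all of it but `x`. -/
theorem exists_intermediateField_trdeg_le_one {k κ : Type*} [Field k] [Field κ] [Algebra k κ]
    {x : κ} (hx : Transcendental k x) :
    ∃ E : IntermediateField k κ, Transcendental E x ∧ Algebra.trdeg E κ ≤ 1 := by
  have hxi : AlgebraicIndepOn k id ({x} : Set κ) :=
    (algebraicIndependent_singleton_iff (x := fun y : ({x} : Set κ) => (y : κ)) ⟨x, rfl⟩).2 hx
  obtain ⟨B, hxB, hB⟩ := exists_isTranscendenceBasis_superset hxi
  have hxB' : x ∈ B := hxB rfl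
  obtain ⟨E, hE⟩ : ∃ E, E = IntermediateField.adjoin k (B \ {x}) := ⟨_, rfl⟩
  refine ⟨E, ?_, ?_⟩
  · rw [hE, IntermediateField.transcendental_adjoin_iff]
    have := (AlgebraicIndepOn.insert_iff (R := k) (x := (id : κ → κ)) (s := B \ {x}) (i := x)
      (by simp)).1 (by rw [Set.insert_sdiff_singleton, Set.insert_eq_of_mem hxB']; exact hB.1)
    rw [Set.image_id] at this
    exact this.2
  · have halg := hB.isAlgebraic
    rw [Subtype.range_coe] at halg
    have hx' : x ∈ Algebra.adjoin E {x} := Algebra.self_mem_adjoin_singleton E x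
    have hle : Algebra.adjoin k B ≤ (Algebra.adjoin E {x}).restrictScalars k := by
      rw [Algebra.adjoin_le_iff]
      intro b hb
      by_cases hbx : b = x
      · rw [hbx]; exact hx'
      · have hbE : b ∈ E := hE ▸ IntermediateField.subset_adjoin k _ ⟨hb, hbx⟩
        exact (Algebra.adjoin E {x}).algebraMap_mem ⟨b, hbE⟩
    have : Algebra.IsAlgebraic (Algebra.adjoin E {x}) κ :=
      ⟨fun y => (halg.isAlgebraic y).tower_top_of_subalgebra_le hle⟩
    simpa using Algebra.IsAlgebraic.trdeg_le_cardinalMk E ({x} : Set κ)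

theorem exists_finite_forall_mem {k κ : Type*} [Field k] [Field κ] [Algebra k κ]
    {Fq : Type*} [Field Fq] [Fintype Fq] [Algebra Fq κ] (G : Finset κ)
    (hG : ∀ x : κ, ∃ e ≠ 0, x ^ e ∈ Subfield.closure (G : Set κ))
    (hperf : ∀ (x : κ) (n : ℕ), ∃ y, y ^ Fintype.card Fq ^ n = x) {r : ℕ} (hr : 2 ≤ r)
    {a : ℕ → κ} (ha : a r = 1) {i₀ : ℕ} (hi₀ : i₀ ≤ r) (ht : Transcendental k (a i₀)) :
    ∃ W : Set κ, W.Finite ∧ ∀ (n : ℕ) (x : Fin n → κ), ∃ m : ℕ, ∀ (G : Fq[X]) (ε : Fin n → Fq[X])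
      (z : κ), G ≠ 0 → (∀ i, (ε i).natDegree + m ≤ G.natDegree) → m ≤ G.natDegree →
      aeval (additivePoly Fq r a) G z = ∑ i, aeval (additivePoly Fq r a) (ε i) (x i) → z ∈ W := by
  obtain ⟨E, hE, hE1⟩ := exists_intermediateField_trdeg_le_one ht
  exact ⟨smallPoints E Fq r a, finite_smallPoints hE1 G hG ha hi₀ hE, fun n x =>
    exists_forall_mem_smallPoints hE1 hperf hr ha hi₀ hE x⟩

/-- Finiteness of saturations and of the torsion of an `𝔽_q[X]`-module that embeds in a field, so
that `X` acts as an additive polynomial with a transcendental coefficient. -/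
theorem fg_saturation_and_finite_torsion {k κ : Type*} [Field k] [Field κ] [Algebra k κ]
    {Fq : Type*} [Field Fq] [Fintype Fq] [Algebra Fq κ] (G : Finset κ)
    (hG : ∀ x : κ, ∃ e ≠ 0, x ^ e ∈ Subfield.closure (G : Set κ))
    (hperf : ∀ (x : κ) (n : ℕ), ∃ y, y ^ Fintype.card Fq ^ n = x) {r : ℕ} (hr : 2 ≤ r)
    {a : ℕ → κ} (ha : a r = 1) {i₀ : ℕ} (hi₀ : i₀ ≤ r) (ht : Transcendental k (a i₀))
    {M : Type*} [AddCommGroup M] [Module Fq[X] M] (j : M →+ κ) (hj : Function.Injective j)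
    (hC : ∀ (c : Fq) x, j ((C c : Fq[X]) • x) = c • j x)
    (hX : ∀ x, j ((X : Fq[X]) • x) = additivePoly Fq r a (j x)) :
    (∀ N : Submodule Fq[X] M, N.FG → N.saturation.FG) ∧
      {x : M | ∃ g : Fq[X], g ≠ 0 ∧ g • x = 0}.Finite := by
  have hXn : ∀ (n : ℕ) x, j ((X ^ n : Fq[X]) • x) = (additivePoly Fq r a ^ n) (j x) := by
    intro n
    induction n with
    | zero => simp
    | succ n ih => intro x; rw [pow_succ, mul_smul, ih, hX, pow_succ, Module.End.mul_apply]
  have hjg : ∀ (g : Fq[X]) x, j (g • x) = aeval (additivePoly Fq r a) g (j x) := by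
    intro g x
    induction g using Polynomial.induction_on' with
    | add p q hp hq => rw [add_smul, map_add, hp, hq, map_add, LinearMap.add_apply]
    | monomial n c =>
      rw [← C_mul_X_pow_eq_monomial, mul_smul, hC, hXn, map_mul, aeval_C, map_pow, aeval_X,
        Module.End.mul_apply, Module.algebraMap_end_apply]
  obtain ⟨W, hW, H⟩ := exists_finite_forall_mem G hG hperf hr ha hi₀ ht
  have hW' : (j ⁻¹' W).Finite := hW.preimage hj.injOn
  have H' : ∀ (n : ℕ) (x : Fin n → M), ∃ m : ℕ, ∀ (G : Fq[X]) (ε : Fin n → Fq[X]) (z : M), G ≠ 0 →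
      (∀ i, (ε i).natDegree + m ≤ G.natDegree) → m ≤ G.natDegree →
      G • z = ∑ i, ε i • x i → z ∈ j ⁻¹' W := by
    intro n x
    obtain ⟨m, hm⟩ := H n (j ∘ x)
    refine ⟨m, fun G ε z hG hε hmG h => hm G ε (j z) hG hε hmG ?_⟩
    rw [← hjg, h, map_sum]
    exact Finset.sum_congr rfl fun i _ => hjg _ _
  exact ⟨fun N hN => fg_saturation_of_finite hW' H' hN, finite_torsion_of_finite hW' H'⟩

end CharP

/-! ### Finitely generated fields -/

section FinitelyGenerated

variable {K : Type*} [Field K]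

theorem IsFinitelyGeneratedField.countable (hK : IsFinitelyGeneratedField K) : Countable K := by
  obtain ⟨s, hs⟩ := hK
  have h := Subfield.cardinalMk_closure_le_max (s : Set K)
  rw [hs, max_eq_right (Cardinal.lt_aleph0_of_finite _).le, Cardinal.mk_le_aleph0_iff] at h
  exact Subfield.topEquiv.symm.injective.countable

/-- A finitely generated perfect field of positive characteristic is algebraic over its prime
field. -/
theorem IsFinitelyGeneratedField.isAlgebraic_of_surjective_pow (hK : IsFinitelyGeneratedField K)
    (p : ℕ) [Fact p.Prime] [Algebra (ZMod p) K] (h : ∀ x : K, ∃ y, y ^ p = x) :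
    Algebra.IsAlgebraic (ZMod p) K := by
  have : CharP K p := charP_of_injective_algebraMap (algebraMap (ZMod p) K).injective p
  obtain ⟨s, hs⟩ := hK
  have : Algebra.EssFiniteType (ZMod p) K := by
    refine IntermediateField.fg_top_iff.1 ⟨s, top_le_iff.1 fun x _ => ?_⟩
    have hle : Subfield.closure (s : Set K) ≤
        (IntermediateField.adjoin (ZMod p) (s : Set K)).toSubfield :=
      Subfield.closure_le.2 (IntermediateField.subset_adjoin _ _)
    exact hle (hs ▸ Subfield.mem_top x)
  -- Every element is a `p`-th power, so every differential vanishes, and an unramified finitely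
  -- generated extension of a field is finite.
  have : Algebra.FormallyUnramified (ZMod p) K := by
    refine ⟨?_⟩
    have hD : ∀ x : K, KaehlerDifferential.D (ZMod p) K x = 0 := fun x => by
      obtain ⟨y, rfl⟩ := h x
      rw [Derivation.leibniz_pow, ← Nat.cast_smul_eq_nsmul K, CharP.cast_eq_zero, zero_smul]
    rw [← Submodule.subsingleton_iff K, ← subsingleton_iff_bot_eq_top,
      ← KaehlerDifferential.span_range_derivation, eq_comm, Submodule.span_eq_bot]
    rintro _ ⟨x, rfl⟩
    exact hD x
  have : Module.Finite (ZMod p) K := Algebra.FormallyUnramified.finite_of_free (ZMod p) K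
  exact Algebra.IsAlgebraic.of_finite _ _

end FinitelyGenerated

/-! ### Coefficients of Drinfeld modules -/

namespace DrinfeldModule

variable {Fq : Type*} [Field Fq] [Fintype Fq] {A K : Type*} [CommRing A] [Algebra Fq A] [Field K]
  [Algebra Fq K] {i : A →ₐ[Fq] K}

/-- Degrees in `τ` add under multiplication, so a root of unity has degree zero. -/
theorem toRingHom_eq_C_of_pow_eq_one (φ : DrinfeldModule i) {a : A} {m : ℕ} (hm : m ≠ 0)
    (ha : a ^ m = 1) : φ.toRingHom a = TwistedPoly.C (i a) := by
  refine TwistedPoly.ext_coeff fun n => ?_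
  rw [TwistedPoly.coeff_C]
  split_ifs with hn
  · rw [hn, φ.coeff_zero]
  · by_contra h
    obtain ⟨d, hnd, hd⟩ := TwistedPoly.exists_hasDegree h
    have h1 := hd.pow m
    rw [← map_pow, ha, map_one] at h1
    have h2 := TwistedPoly.hasDegree_one.eq h1
    have := mul_ne_zero hm (show d ≠ 0 by omega)
    exact this h2.symm

/-- `φ` is only assumed to be a ring homomorphism; its `𝔽_q`-linearity follows because nonzero
constants are roots of unity. -/
theorem toRingHom_algebraMap (φ : DrinfeldModule i) (c : Fq) :
    φ.toRingHom (algebraMap Fq A c) = TwistedPoly.C (algebraMap Fq K c) := by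
  by_cases hc : c = 0
  · rw [hc, map_zero, map_zero, map_zero, map_zero]
  · have h := φ.toRingHom_eq_C_of_pow_eq_one (a := algebraMap Fq A c)
      (Nat.sub_ne_zero_of_lt (Fintype.one_lt_card (α := Fq)))
      (by rw [← map_pow, FiniteField.pow_card_sub_one_eq_one c hc, map_one])
    rw [h, AlgHom.commutes]

theorem _root_.exists_pow_eq_one_of_isAlgebraic [IsDomain A] {a : A} (ha : IsAlgebraic Fq a)
    (ha0 : a ≠ 0) : ∃ m ≠ 0, a ^ m = 1 := by
  have : Module.Finite Fq (Algebra.adjoin Fq {a}) :=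
    Algebra.finite_adjoin_simple_of_isIntegral ha.isIntegral
  have : Finite (Algebra.adjoin Fq {a}) := Module.finite_of_finite Fq
  obtain ⟨m, n, hmn, h⟩ := Finite.exists_ne_map_eq_of_infinite fun n : ℕ =>
    (⟨a, Algebra.self_mem_adjoin_singleton Fq a⟩ : Algebra.adjoin Fq {a}) ^ n
  have h' : a ^ m = a ^ n := congrArg Subtype.val h
  wlog hlt : m < n generalizing m n
  · exact this n m hmn.symm h.symm h'.symm (by omega)
  refine ⟨n - m, by omega, ?_⟩
  have h1 : a ^ m * a ^ (n - m) = a ^ m * 1 := by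
    rw [← pow_add, Nat.add_sub_cancel' hlt.le, mul_one, h']
  exact mul_left_cancel₀ (pow_ne_zero m ha0) h1

/-- An element with nonconstant image is not a root of unity, hence is transcendental; squaring it
makes the degree at least two. -/
theorem exists_transcendental_hasDegree [IsDomain A] (φ : DrinfeldModule i) :
    ∃ (t : A) (r : ℕ), Transcendental Fq t ∧ 2 ≤ r ∧ (φ.toRingHom t).HasDegree r := by
  obtain ⟨a, ha⟩ := φ.exists_ne
  have ha0 : a ≠ 0 := by
    rintro rfl
    exact ha (by rw [map_zero, map_zero, map_zero])
  have hat : Transcendental Fq a := fun h => by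
    obtain ⟨m, hm, hm1⟩ := exists_pow_eq_one_of_isAlgebraic h ha0
    exact ha (φ.toRingHom_eq_C_of_pow_eq_one hm hm1)
  obtain ⟨n, hn, hn0⟩ : ∃ n ≠ 0, (φ.toRingHom a).coeff n ≠ 0 := by
    by_contra! h
    refine ha (TwistedPoly.ext_coeff fun n => ?_)
    rw [TwistedPoly.coeff_C]
    split_ifs with hn
    · rw [hn, φ.coeff_zero]
    · exact h n hn
  obtain ⟨d, hnd, hd⟩ := TwistedPoly.exists_hasDegree hn0
  refine ⟨a ^ 2, 2 * d, hat.pow two_pos, by omega, ?_⟩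
  rw [map_pow]
  exact hd.pow 2

theorem trdeg_fieldOfDefinition_eq_zero (p : ℕ) [Fact p.Prime] [Algebra (ZMod p) K]
    (φ : DrinfeldModule i) (h : ∀ a n, IsAlgebraic (ZMod p) ((φ.toRingHom a).coeff n)) :
    Algebra.trdeg (⊥ : Subfield φ.fieldOfDefinition) φ.fieldOfDefinition = 0 := by
  have : CharP K p := charP_of_injective_algebraMap (algebraMap (ZMod p) K).injective p
  set E := φ.fieldOfDefinition with hE
  have hle : E ≤ (algebraicClosure (ZMod p) K).toSubfield := by
    rw [hE, fieldOfDefinition, Subfield.closure_le]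
    rintro _ ⟨a, n, rfl⟩
    exact mem_algebraicClosure_iff.2 (h a n)
  have hEp : CharP E p := (RingHom.charP_iff E.subtype E.subtype.injective p).2 ‹_›
  have : CharP (⊥ : Subfield E) p :=
    (RingHom.charP_iff _ (⊥ : Subfield E).subtype.injective p).2 hEp
  let f := ZMod.castHom (dvd_refl p) (⊥ : Subfield E)
  have : Algebra.IsAlgebraic (⊥ : Subfield E) E := ⟨fun x => by
    obtain ⟨P, hP0, hP⟩ := mem_algebraicClosure_iff.1 (hle x.2)
    refine ⟨P.map f, (Polynomial.map_ne_zero_iff f.injective).2 hP0, E.subtype.injective ?_⟩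
    rw [Polynomial.aeval_def, Polynomial.eval₂_map, Polynomial.hom_eval₂, map_zero, ← hP,
      Polynomial.aeval_def]
    congr 1
    exact Subsingleton.elim _ _⟩
  exact trdeg_eq_zero

/-- Otherwise every valuation ring over `𝔽_p` contains the coefficients of `φ_t`, and by commutation
those of every `φ_a`. All coefficients would then be algebraic, and so would the field of
definition. -/
theorem exists_transcendental_coeff (p : ℕ) [Fact p.Prime] [Algebra (ZMod p) K]
    (φ : DrinfeldModule i)
    (hφ : 0 < Algebra.trdeg (⊥ : Subfield φ.fieldOfDefinition) φ.fieldOfDefinition)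
    {t : A} {r : ℕ} (hr : r ≠ 0) (hlead : (φ.toRingHom t).coeff r = 1)
    (hdeg : ∀ n, r < n → (φ.toRingHom t).coeff n = 0) :
    ∃ n ≤ r, Transcendental (ZMod p) ((φ.toRingHom t).coeff n) := by
  by_contra! h
  refine hφ.ne' (φ.trdeg_fieldOfDefinition_eq_zero p fun a n => ?_)
  refine (isIntegral_of_forall_mem_valuationSubring fun O hO => ?_).isAlgebraic
  refine TwistedPoly.coeff_mem_of_commute hr hlead hdeg (fun m => ?_)
    (by rw [← map_mul, ← map_mul, mul_comm]) n
  by_cases hm : m ≤ r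
  · exact ValuationSubring.mem_of_isIntegral hO (not_not.1 (h m hm)).isIntegral
  · rw [hdeg m (not_le.1 hm)]
    exact O.zero_mem

/-- If the points of a Drinfeld module over a purely inseparable perfect extension of its field of
coefficients are finitely generated, then this field of coefficients is perfect. -/
theorem exists_pow_eq_of_finite_points (p : ℕ) [Fact p.Prime] [CharP K p] (φ : DrinfeldModule i)
    {L : Type*} [Field L] [Algebra K L] (hL : ∀ x : L, ∃ n, x ^ p ^ n ∈ (algebraMap K L).range)
    (hp : ∀ (x : L) (n : ℕ), ∃ y, y ^ p ^ n = x) (hfin : Module.Finite A (φ.Points L)) (x : K) :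
    ∃ y, y ^ p = x := by
  have : CharP L p := charP_of_injective_algebraMap (algebraMap K L).injective p
  let e : φ.Points L → L := fun x => x
  -- The points in `K^(1/p^N)` form a submodule because the coefficients of `φ` lie in `K`; finite
  -- generation puts all points into one of these.
  let S : ℕ → Submodule A (φ.Points L) := fun N =>
    { carrier := {x | e x ^ p ^ N ∈ (algebraMap K L).range}
      zero_mem' := by
        change (0 : L) ^ p ^ N ∈ (algebraMap K L).range
        rw [zero_pow (pow_ne_zero _ (Fact.out : p.Prime).ne_zero)]
        exact zero_mem _
      add_mem' := fun {x y} hx hy => by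
        change (e x + e y) ^ p ^ N ∈ (algebraMap K L).range
        rw [add_pow_char_pow]
        exact add_mem hx hy
      smul_mem' := fun a x hx => by
        change TwistedPoly.toEnd L (φ.toRingHom a) (e x) ^ p ^ N ∈ (algebraMap K L).range
        rw [TwistedPoly.toEnd_apply, sum_pow_char_pow]
        refine sum_mem fun n _ => ?_
        rw [mul_pow, pow_right_comm]
        exact mul_mem (pow_mem (RingHom.mem_range_self _ _) _)
          (pow_mem (show e x ^ p ^ N ∈ (algebraMap K L).range from hx) _) }
  have hmono : Monotone S := monotone_nat_of_le_succ fun N x hx => by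
    change e x ^ p ^ (N + 1) ∈ (algebraMap K L).range
    rw [pow_succ, pow_mul]
    exact pow_mem (show e x ^ p ^ N ∈ (algebraMap K L).range from hx) p
  obtain ⟨s, hs⟩ := hfin.fg_top
  choose! N hN using hL
  have htop : ∀ x : L, x ^ p ^ s.sup N ∈ (algebraMap K L).range := fun x => by
    have hle : Submodule.span A (s : Set (φ.Points L)) ≤ S (s.sup N) :=
      Submodule.span_le.2 fun y hy => hmono (Finset.le_sup hy) (hN y)
    rw [hs] at hle
    exact hle (x := x) trivial
  -- One root more than the uniform bound: the `p ^ N`-th power of `y` lies in `K` and is a `p`-th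
  -- root of `x`.
  obtain ⟨y, hy⟩ := hp (algebraMap K L x) (s.sup N + 1)
  obtain ⟨z, hz⟩ := htop y
  refine ⟨z, (algebraMap K L).injective ?_⟩
  rw [map_pow, hz, ← pow_mul, ← pow_succ, hy]

end DrinfeldModule

open scoped IntermediateField

/-- Every element of the perfect closure of `K(γ)` has a power in a fixed finitely generated field,
if `K` is finitely generated. -/
theorem exists_finset_pow_mem_closure_perfectClosure_adjoin {K Ω : Type*} [Field K] [Field Ω]
    [Algebra K Ω] (γ : Ω) {s : Finset K} (hs : Subfield.closure (s : Set K) = ⊤) :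
    ∃ G : Finset (perfectClosure K⟮γ⟯ Ω), ∀ x : perfectClosure K⟮γ⟯ Ω,
      ∃ e ≠ 0, x ^ e ∈ Subfield.closure (G : Set (perfectClosure K⟮γ⟯ Ω)) := by
  classical
  let ι : K⟮γ⟯ →+* perfectClosure K⟮γ⟯ Ω := algebraMap _ _
  let G : Finset (perfectClosure K⟮γ⟯ Ω) :=
    insert (ι (IntermediateField.AdjoinSimple.gen K γ)) (s.image fun c => ι (algebraMap K K⟮γ⟯ c))
  set H := Subfield.closure (G : Set (perfectClosure K⟮γ⟯ Ω)) with hH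
  have hsub : (G : Set (perfectClosure K⟮γ⟯ Ω)) ⊆ H := Subfield.subset_closure
  have hK : ∀ c : K, ι (algebraMap K K⟮γ⟯ c) ∈ H := fun c => by
    have hle : Subfield.closure (s : Set K) ≤ H.comap (ι.comp (algebraMap K K⟮γ⟯)) :=
      Subfield.closure_le.2 fun c hc => hsub (by
        simp only [G, Finset.coe_insert, Finset.coe_image]
        exact Or.inr ⟨c, hc, rfl⟩)
    rw [hs] at hle
    exact hle (Subfield.mem_top c)
  let H' : IntermediateField K Ω :=
    (H.map (algebraMap (perfectClosure K⟮γ⟯ Ω) Ω)).toIntermediateField fun c => ⟨_, hK c, rfl⟩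
  have hle : K⟮γ⟯ ≤ H' := by
    rw [IntermediateField.adjoin_simple_le_iff]
    exact ⟨_, hsub (Finset.mem_insert_self _ _), rfl⟩
  refine ⟨G, fun x => ?_⟩
  obtain ⟨n, y, hy⟩ := mem_perfectClosure_iff.1 x.2
  refine ⟨ringExpChar K⟮γ⟯ ^ n, pow_ne_zero _ (expChar_pos K⟮γ⟯ _).ne', ?_⟩
  obtain ⟨z, hz, hzy⟩ := hle y.2
  have : x ^ ringExpChar K⟮γ⟯ ^ n = z := Subtype.ext (by
    rw [SubmonoidClass.coe_pow, ← hy]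
    exact hzy.symm)
  rw [this]
  exact hz

theorem pow_card_surjective (p : ℕ) [Fact p.Prime] (Fq : Type*) [Field Fq] [Fintype Fq] [CharP Fq p]
    (L : Type*) [Field L] [CharP L p] [PerfectRing L p] (x : L) (n : ℕ) :
    ∃ y, y ^ Fintype.card Fq ^ n = x := by
  obtain ⟨m, -, hm⟩ := FiniteField.card Fq p
  obtain ⟨y, hy⟩ := (iterateFrobeniusEquiv L p (m * n)).surjective x
  refine ⟨y, ?_⟩
  rw [hm, ← pow_mul, ← hy, iterateFrobeniusEquiv_apply, iterateFrobenius_def]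

theorem corollaryT (p : ℕ) [Fact p.Prime]
    -- the finite field of constants, with `q` elements, of characteristic `p`
    (Fq : Type*) [Field Fq] [Fintype Fq] [CharP Fq p]
    -- a nonsingular projective curve over `Fq` and a closed point `P` of it
    (F : Type*) [Field F] [Algebra Fq F] (hF : IsCurveFunctionField Fq F)
    (P : CurvePoint Fq F)
    -- a finitely generated field extension `K` of `Fq` and an algebraic closure of it
    (K : Type*) [Field K] [Algebra Fq K] (hK : IsFinitelyGeneratedField K)
    (Kalg : Type*) [Field Kalg] [Algebra K Kalg] [IsAlgClosure K Kalg]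
    [Algebra Fq Kalg] [IsScalarTower Fq K Kalg]
    -- a Drinfeld module of positive modular transcendence degree
    (i : regularAway P →ₐ[Fq] K) (φ : DrinfeldModule i)
    (hφ : 0 < φ.modularTrdeg Kalg) :
    ∃ T M : Submodule (regularAway P) (φ.Points (perfectClosure K Kalg)),
      IsCompl T M ∧
      Finite T ∧ Module.IsTorsion (regularAway P) T ∧
      Module.Free (regularAway P) M ∧
      Module.rank (regularAway P) M = Cardinal.aleph0 := by
  have : IsAlgClosed Kalg := IsAlgClosure.isAlgClosed K
  have : Algebra.IsAlgebraic K Kalg := IsAlgClosure.isAlgebraic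
  have hKp : CharP K p := charP_of_injective_algebraMap (algebraMap Fq K).injective p
  have : CharP Kalg p := charP_of_injective_algebraMap (algebraMap K Kalg).injective p
  have : Countable K := hK.countable
  obtain ⟨t, r, ht, hr, hdeg⟩ := φ.exists_transcendental_hasDegree
  set q := Fintype.card Fq with hq
  have hq1 : 1 < q := Fintype.one_lt_card
  set b : ℕ → K := (φ.toRingHom t).coeff with hb
  have hqr : 1 < q ^ r := Nat.one_lt_pow (by omega) hq1
  -- Conjugation multiplies the leading coefficient by `γ ^ (q ^ r - 1)`, so this `γ` makes it one.
  obtain ⟨γ, hγ⟩ := IsAlgClosed.exists_pow_nat_eq (algebraMap K Kalg (b r))⁻¹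
    (Nat.sub_pos_of_lt hqr)
  have hbr : algebraMap K Kalg (b r) ≠ 0 := (map_ne_zero _).2 hdeg.1
  have hγ0 : γ ≠ 0 := by
    rintro rfl
    rw [zero_pow (Nat.sub_pos_of_lt hqr).ne', eq_comm, inv_eq_zero] at hγ
    exact hbr hγ
  let ψ := (φ.baseChange (IsScalarTower.toAlgHom Fq K Kalg)).conj (Units.mk0 γ hγ0)
  have hψ : ∀ n, (ψ.toRingHom t).coeff n = algebraMap K Kalg (b n) * γ ^ (q ^ n - 1) := fun n => by
    refine (DrinfeldModule.coeff_conj _ _ _ _).trans ?_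
    rw [Units.val_mk0]
    congr 1
    exact TwistedPoly.coeff_map _ _ _
  have hψr : (ψ.toRingHom t).coeff r = 1 := by rw [hψ, hγ, mul_inv_cancel₀ hbr]
  have hψ0 : ∀ n, r < n → (ψ.toRingHom t).coeff n = 0 := fun n hn => by
    rw [hψ, hb, hdeg.2 n hn, map_zero, zero_mul]
  let _ : Algebra (ZMod p) Kalg := ZMod.algebra Kalg p
  -- The minimum over all conjugates is at most the value at this `γ`, which is therefore positive.
  obtain ⟨n₀, hn₀, htr⟩ := ψ.exists_transcendental_coeff p
    (hφ.trans_le (ciInf_le' _ (Units.mk0 γ hγ0))) (by omega) hψr hψ0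
  have : ExpChar Kalg p := ExpChar.prime Fact.out
  have : ExpChar K p := ExpChar.prime Fact.out
  have : PerfectRing Kalg p := inferInstance
  -- the field generated by `γ` over `K`, and its perfect closure
  have hKγ : CharP K⟮γ⟯ p := charP_of_injective_algebraMap (algebraMap K K⟮γ⟯).injective p
  have : ExpChar K⟮γ⟯ p := ExpChar.prime Fact.out
  let L := perfectClosure K Kalg
  let κ := perfectClosure K⟮γ⟯ Kalg
  have : CharP L p := charP_of_injective_algebraMap (algebraMap K L).injective p
  have : CharP κ p := charP_of_injective_algebraMap (algebraMap K⟮γ⟯ κ).injective p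
  let _ : Algebra (ZMod p) κ := ZMod.algebra κ p
  let _ : Algebra Fq κ :=
    (((algebraMap K⟮γ⟯ κ).comp (algebraMap K K⟮γ⟯)).comp (algebraMap Fq K)).toAlgebra
  let κι : κ →+* Kalg := algebraMap κ Kalg
  have hκι : Function.Injective κι := κι.injective
  let γ' : κ := algebraMap K⟮γ⟯ κ (IntermediateField.AdjoinSimple.gen K γ)
  have hγ' : κι γ' = γ := rfl
  have hγ'0 : γ' ≠ 0 := fun h => hγ0 (by rw [← hγ', h, map_zero])
  let a : ℕ → κ := fun n => algebraMap K⟮γ⟯ κ (algebraMap K K⟮γ⟯ (b n)) * γ' ^ (q ^ n - 1)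
  have ha : ∀ n, κι (a n) = algebraMap K Kalg (b n) * γ ^ (q ^ n - 1) := fun n => by
    simp only [a]
    rw [map_mul, map_pow, hγ']
    rfl
  have har : a r = 1 := hκι (by rw [ha, ← hψ, hψr, map_one])
  have hat : Transcendental (ZMod p) (a n₀) := fun h => htr <| by
    rw [hψ, ← ha]
    obtain ⟨Q, hQ0, hQ⟩ := h
    refine ⟨Q, hQ0, ?_⟩
    rw [Polynomial.aeval_def] at hQ ⊢
    rw [← map_zero κι, ← hQ, Polynomial.hom_eval₂]
    congr 1
    exact Subsingleton.elim _ _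
  obtain ⟨s, hs⟩ := id hK
  obtain ⟨G, hG⟩ := exists_finset_pow_mem_closure_perfectClosure_adjoin (Ω := Kalg) γ hs
  let ι : L →+* κ := (algebraMap L Kalg).codRestrict κ fun x => by
    obtain ⟨n, y, hy⟩ := (mem_perfectClosure_iff_pow_mem p).1 x.2
    exact (mem_perfectClosure_iff_pow_mem p).2 ⟨n, algebraMap K K⟮γ⟯ y, hy⟩
  -- Since `γ` need not lie in `K^per`, points are compared in the larger field `κ`; division by `γ`
  -- turns the action of `φ_t` into that of the monic `ψ_t`.
  let j : φ.Points L →+ κ := (AddMonoidHom.mulLeft γ'⁻¹).comp (ι : L →+ κ)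
  have hj : ∀ x : L, j x = γ'⁻¹ * ι x := fun _ => rfl
  have hjinj : Function.Injective j := fun x y hxy =>
    ι.injective (mul_left_cancel₀ (inv_ne_zero hγ'0) hxy)
  let _ : Module (Polynomial Fq) (φ.Points L) :=
    Module.compHom (φ.Points L) (Polynomial.aeval t : Polynomial Fq →ₐ[Fq] _).toRingHom
  have hsmul : ∀ (g : Polynomial Fq) (x : φ.Points L), g • x = Polynomial.aeval t g • x :=
    fun _ _ => rfl
  have hC : ∀ (c : Fq) x, j ((Polynomial.C c : Polynomial Fq) • x) = c • j x := fun c (x : L) => by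
    have h : φ.toRingHom (Polynomial.aeval t (Polynomial.C c)) =
        TwistedPoly.C (algebraMap Fq K c) := by
      rw [Polynomial.aeval_C, DrinfeldModule.toRingHom_algebraMap]
    have h0 : ∀ n, 0 < n → (φ.toRingHom (Polynomial.aeval t (Polynomial.C c))).coeff n = 0 :=
      fun n hn => by rw [h, TwistedPoly.coeff_C, if_neg hn.ne']
    refine (congrArg (fun y : L => γ'⁻¹ * ι y) (TwistedPoly.toEnd_eq_sum_range L h0 x)).trans ?_
    rw [zero_add, Finset.sum_range_one, h, TwistedPoly.coeff_C, if_pos rfl, pow_zero, pow_one,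
      map_mul, mul_left_comm, Algebra.smul_def]
    rfl
  have hX : ∀ x, j ((Polynomial.X : Polynomial Fq) • x) = additivePoly Fq r a (j x) :=
      fun (x : L) => by
    have h0 : ∀ n, r < n →
        (φ.toRingHom (Polynomial.aeval t (Polynomial.X : Polynomial Fq))).coeff n = 0 := by
      rw [Polynomial.aeval_X]; exact hdeg.2
    refine (congrArg (fun y : L => γ'⁻¹ * ι y) (TwistedPoly.toEnd_eq_sum_range L h0 x)).trans ?_
    rw [Polynomial.aeval_X, additivePoly_apply, hj, map_sum, Finset.mul_sum]
    refine Finset.sum_congr rfl fun n _ => hκι ?_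
    have hq0 : q ^ n ≠ 0 := pow_ne_zero _ (by omega)
    have hb' : κι (ι (algebraMap K L (b n))) = algebraMap K Kalg (b n) := rfl
    rw [map_mul ι, map_pow ι, map_mul κι, map_mul κι, map_mul κι (a n), ha, map_pow κι, map_pow κι,
      map_mul κι, map_inv₀, hγ', hb', mul_pow, inv_pow, ← hq, mul_assoc]
    have h1 : γ ^ (q ^ n - 1) * (γ ^ q ^ n)⁻¹ = γ⁻¹ := by
      rw [← pow_sub_one_mul hq0 γ, mul_inv, mul_inv_cancel_left₀ (pow_ne_zero _ hγ0)]
    rw [← h1]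
    ring
  obtain ⟨hsat, htors⟩ := fg_saturation_and_finite_torsion G hG
    (pow_card_surjective p Fq κ) hr har hn₀ hat j hjinj hC hX
  have : Countable Kalg := Set.countable_univ_iff.1
    ((Algebraic.countable K Kalg).mono fun x _ => Algebra.IsAlgebraic.isAlgebraic x)
  have : Countable (φ.Points L) := Subtype.countable
  -- Finite generation would make `K` perfect, hence algebraic over `𝔽_p` together with `Kalg`,
  -- against the transcendental coefficient.
  refine exists_isCompl_torsion_free_regularAway hF ht hsmul hsat htors fun hfin => htr ?_
  let _ : Algebra (ZMod p) K := ZMod.algebra K p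
  have := hK.isAlgebraic_of_surjective_pow p (φ.exists_pow_eq_of_finite_points p (L := L)
    (fun x => by
      obtain ⟨n, y, hy⟩ := (mem_perfectClosure_iff_pow_mem p).1 x.2
      exact ⟨n, y, Subtype.ext hy⟩)
    (fun x n => (iterateFrobeniusEquiv L p n).surjective x) hfin)
  have : IsScalarTower (ZMod p) K Kalg :=
    IsScalarTower.of_algebraMap_eq' (Subsingleton.elim _ _)
  exact (Algebra.IsAlgebraic.trans (ZMod p) K Kalg).isAlgebraic _
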